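/- Let $m,q,k\ge 1$ be integers, let $d\mid m$, and let $\Omega$ be an alphabet with $|\Omega|=q$. A cyclic sequence $(s)$ over $\Omega$ is a finite sequence $s$ up to rotation; a $k$-mer is an element of $\Omega^k$, and its occurrences in $(s)$ are counted by starting position, reading cyclically (positions may be reused if $s$ is shorter than $k$). Let $\mathcal C(m,q,k)$ be the set of cyclic sequences in which every $k$-mer occurs exactly $m$ times, and $\mathcal{LC}(m,q,k)$ the set of their linearizations, i.e. of the sequences $s$ with $(s)\in\mathcal C(m,q,k)$. With $\rho(a_1\ldots a_n)=a_na_1\ldots a_{n-1}$, the order of a sequence $s$ of length $n$, or of $(s)$, is the largest $e\mid n$ with $\rho^{n/e}(s)=s$. Let $\mathcal C^{(d)}(m,q,k)$ and $\mathcal{LC}^{(d)}(m,q,k)$ be the subsets of elements of order $d$, and, for $y\in\Omega^k$, let $\mathcal{LC}^{(d)}_y(m,q,k)$ be the set of those elements of $\mathcal{LC}^{(d)}(m,q,k)$ that start with $y$ (read cyclically). Write $t^d$ for the concatenation of $d$ copies of $t$, and put $W(m,q,k)=\left((mq)!/(m!)^q\right)^{q^{k-1}}$. Then all these sets of order-$d$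 sequences are finite, every $s\in\mathcal{LC}^{(d)}(m,q,k)$ is $s=t^d$ for a unique sequence $t$, its $d$-th root (the first $1/d$ of $s$), and: (a) $s=t^d\mapsto t$ is a bijection $\mathcal{LC}^{(d)}(m,q,k)\to\mathcal{LC}^{(1)}(m/d,q,k)$; (b) for each $y\in\Omega^k$ it restricts to a bijection $\mathcal{LC}^{(d)}_y(m,q,k)\to\mathcal{LC}^{(1)}_y(m/d,q,k)$; (c) $(t^d)\mapsto (t)$ is a well-defined bijection $\mathcal C^{(d)}(m,q,k)\to\mathcal C^{(1)}(m/d,q,k)$. In particular, in each of (a), (b), (c) the two sets have the same cardinality. Moreover $$|\mathcal C^{(d)}(m,q,k)|=\frac{1}{(m/d)\,q^k}\sum_{r\mid (m/d)}\mu(r)\,W\!\left(\tfrac{m}{rd},q,k\right),$$ and, for each $y\in\Omega^k$, $$|\mathcal{LC}^{(d)}_y(m,q,k)|=\frac{1}{q^k}\sum_{r\mid (m/d)}\mu(r)\,W\!\left(\tfrac{m}{rd},q,k\right),$$ where $\mu$ is the Möbius function. -/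

import Mathlib

namespace MultiDeBruijn

variable {Ω : Type*}

/-- The sequence `s`, read cyclically from its first position (and around the end as often as
needed if `s` is shorter than `k`), starts with the `k`-mer `w`. For `k ≤ s.length` this says
that `w` is the initial segment of length `k` of `s`. -/
def StartsWith {k : ℕ} (s : List Ω) (w : Fin k → Ω) : Prop :=
  ∀ j : Fin k, s[(j : ℕ) % s.length]? = some (w j)

instance [DecidableEq Ω] {k : ℕ} (s : List Ω) (w : Fin k → Ω) : Decidable (StartsWith s w) := by
  unfold StartsWith; infer_instance

/-- The number of starting positions at which the `k`-mer `w` occurs in the sequence `s` read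
cyclically. -/
def occ [DecidableEq Ω] {k : ℕ} (s : List Ω) (w : Fin k → Ω) : ℕ :=
  ((Finset.range s.length).filter fun i => StartsWith (s.rotate i) w).card

/-- The cyclic shift `a₁ … aₙ ↦ aₙ a₁ … aₙ₋₁`. -/
def rho (s : List Ω) : List Ω := s.rotate (s.length - 1)

/-- The order of a sequence `s` of length `n`: the largest divisor `d` of `n` for which the
`n / d`-th iterate of the cyclic shift fixes `s`. -/
def order [DecidableEq Ω] (s : List Ω) : ℕ :=
  ((Nat.divisors s.length).filter fun d => rho^[s.length / d] s = s).sup id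

/-- The concatenation `s ^ d` of `d` copies of `s`. -/
def seqPow (s : List Ω) (d : ℕ) : List Ω := (List.replicate d s).flatten

/-- The first of the `d` equal parts of `s` (used when `s = t ^ d`, where it is `t`). -/
def seqRoot (d : ℕ) (s : List Ω) : List Ω := s.take (s.length / d)

theorem occ_rotate [DecidableEq Ω] {k : ℕ} (s : List Ω) (j : ℕ) (w : Fin k → Ω) :
    occ (s.rotate j) w = occ s w := by
  have hp : Function.Periodic (fun i => StartsWith (s.rotate i) w) s.length := by
    intro i
    have h : s.rotate (i + s.length) = s.rotate i := by
      rw [← List.rotate_mod, Nat.add_mod_right, List.rotate_mod]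
    simp only [h]
  have h1 := Nat.filter_Ico_card_eq_of_periodic j s.length _ hp
  rw [Nat.count_eq_card_filter_range] at h1
  unfold occ
  rw [← h1, List.length_rotate]
  refine Finset.card_bij (fun i _ => j + i) ?_ ?_ ?_
  · intro i hi
    simp only [Finset.mem_filter, Finset.mem_range, Finset.mem_Ico, List.rotate_rotate] at hi ⊢
    exact ⟨by omega, hi.2⟩
  · intro a _ b _ h
    simpa using h
  · intro b hb
    simp only [Finset.mem_filter, Finset.mem_Ico] at hb
    refine ⟨b - j, ?_, by omega⟩
    simp only [Finset.mem_filter, Finset.mem_range, List.rotate_rotate]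
    have : j + (b - j) = b := by omega
    rw [this]
    exact ⟨by omega, hb.2⟩

theorem rho_iterate_rotate (s : List Ω) (j i : ℕ) :
    rho^[i] (s.rotate j) = (rho^[i] s).rotate j := by
  induction i generalizing s with
  | zero => rfl
  | succ i ih =>
    have h : rho (s.rotate j) = (rho s).rotate j := by
      simp [rho, List.rotate_rotate, Nat.add_comm]
    rw [Function.iterate_succ_apply, Function.iterate_succ_apply, h, ih]

theorem order_rotate [DecidableEq Ω] (s : List Ω) (j : ℕ) : order (s.rotate j) = order s := by
  unfold order
  simp only [List.length_rotate, rho_iterate_rotate, List.rotate_eq_rotate]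

/-- The number of occurrences of a `k`-mer in a cyclic sequence. -/
def cyclicOcc [DecidableEq Ω] {k : ℕ} (σ : Cycle Ω) (w : Fin k → Ω) : ℕ :=
  Quotient.liftOn σ (fun s => occ s w) (by
    rintro s _ ⟨j, rfl⟩
    exact (occ_rotate s j w).symm)

/-- The order of a cyclic sequence. -/
def cyclicOrder [DecidableEq Ω] (σ : Cycle Ω) : ℕ :=
  Quotient.liftOn σ order (by
    rintro s _ ⟨j, rfl⟩
    exact (order_rotate s j).symm)

variable (Ω) [DecidableEq Ω]

/-- Cyclic multi de Bruijn sequences over `Ω`: every `k`-mer occurs exactly `m` times. -/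
def C (m k : ℕ) : Set (Cycle Ω) := {σ | ∀ w : Fin k → Ω, cyclicOcc σ w = m}

/-- Linearizations of cyclic multi de Bruijn sequences. -/
def LC (m k : ℕ) : Set (List Ω) := {s | (s : Cycle Ω) ∈ C Ω m k}

/-- Cyclic multi de Bruijn sequences of order `d`. -/
def COrd (d m k : ℕ) : Set (Cycle Ω) := {σ ∈ C Ω m k | cyclicOrder σ = d}

/-- Linearized cyclic multi de Bruijn sequences of order `d`. -/
def LCOrd (d m k : ℕ) : Set (List Ω) := {s ∈ LC Ω m k | order s = d}

variable {Ω}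

/-- Linearized cyclic multi de Bruijn sequences of order `d` that start with the `k`-mer `y`. -/
def LCOrdStart {k : ℕ} (y : Fin k → Ω) (d m : ℕ) : Set (List Ω) :=
  {s ∈ LCOrd Ω d m k | StartsWith s y}

/-- `W(m,q,k) = ((mq)! / (m!) ^ q) ^ (q ^ (k-1))`, for `k ≥ 1`. -/
def W (m q k : ℕ) : ℚ :=
  (((m * q).factorial : ℚ) / (m.factorial : ℚ) ^ q) ^ (q ^ (k - 1))

end MultiDeBruijn

/-! Everything reduces to |LC(m,q,k)| = W(m,q,k). Put n = k-1. A sequence in LC starting with the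
n-mer v is, up to rotation by n, a closed walk from v in the de Bruijn graph on n-mers using each
edge m times. Such walks are counted as in the BEST theorem. A walk is determined by the list of
letters read at each state (`exits_injective`), and a balanced family of lists arises exactly when
its last letters lead every state to v (`image_exits_eq`). The trees are counted by a determinant
(`card_reach_eq_det`). Since n uniform random letters make the n-mer uniform, a power of the
transition matrix is the uniform matrix, which gives the determinant
(`Matrix.card_mul_det_updateRow_one_sub`). By symmetry a fraction 1/q of the arrangements at a state
has a given last letter. Hence W / q^n walks start at each v, and summing over v gives W.

For the bijections, powers and roots are inverse to each other: t^d has d times the k-mer counts of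
t, commutes with rotation, and has order d exactly when t has order 1. Sorting LC by order gives
W(m) as the sum over d | m of |LC^(1)(d)|, and Möbius inversion yields |LC^(1)|. A class of order 1
has m q^k distinct rotations, and the rotations of any sequence start with y exactly m times, whence
the factors in the two formulas. -/

section

open Finset Relation

/-! ### Walks in a deterministic labelled graph and their exit lists -/

section Walks

variable {V Ω : Type*} [DecidableEq V] (δ : V → Ω → V)

/-- For each state `u`, the successive letters read at `u` along the walk from `v` that reads
the word. -/
def exits : V → List Ω → V → List Ω
  | _, [] => fun _ => []
  | v, a :: w => Function.update (exits (δ v a) w) v (a :: exits (δ v a) w v)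

theorem exits_cons_self (v : V) (a : Ω) (w : List Ω) :
    exits δ v (a :: w) v = a :: exits δ (δ v a) w v := by
  simp [exits]

theorem exits_cons_of_ne {u v : V} (h : u ≠ v) (a : Ω) (w : List Ω) :
    exits δ v (a :: w) u = exits δ (δ v a) w u := by
  simp [exits, h]

/-- The walk can be replayed: the head of the list at the current state is the next letter, and the
walk stops where that list is empty. -/
theorem exits_injective (v : V) : Function.Injective (exits δ v) := by
  intro w
  induction w generalizing v with
  | nil =>
    intro w' h
    cases w' with
    | nil => rfl
    | cons b w' => simpa [exits] using congrFun h v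
  | cons a w ih =>
    intro w' h
    cases w' with
    | nil => simpa [exits] using congrFun h v
    | cons b w' =>
      have hv := congrFun h v
      rw [exits_cons_self, exits_cons_self, List.cons.injEq] at hv
      obtain ⟨rfl, hv⟩ := hv
      rw [List.cons.injEq]
      refine ⟨rfl, ih (δ v a) (funext fun u => ?_)⟩
      by_cases hu : u = v
      · rw [hu, hv]
      · simpa [exits_cons_of_ne δ hu] using congrFun h u

/-- The last letter listed at `u` leads to `u'`. -/
def LastStep (T : V → List Ω) (u u' : V) : Prop := ∃ a, (T u).getLast? = some a ∧ δ u a = u'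

theorem lastStep_exits_cons {v : V} {a : Ω} {w : List Ω} {u u' : V}
    (h : LastStep δ (exits δ (δ v a) w) u u') : LastStep δ (exits δ v (a :: w)) u u' := by
  obtain ⟨b, hb, hu⟩ := h
  refine ⟨b, ?_, hu⟩
  by_cases huv : u = v
  · subst huv
    rw [exits_cons_self, List.getLast?_cons, hb]; rfl
  · rwa [exits_cons_of_ne δ huv]

/-- Following last exits leads to the end of the walk. -/
theorem reflTransGen_lastStep_exits (v : V) (w : List Ω) (u : V) (hu : exits δ v w u ≠ []) :
    ReflTransGen (LastStep δ (exits δ v w)) u (w.foldl δ v) := by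
  induction w generalizing v u with
  | nil => simp [exits] at hu
  | cons a w ih =>
    have key : ∀ x, exits δ (δ v a) w x ≠ [] →
        ReflTransGen (LastStep δ (exits δ v (a :: w))) x ((a :: w).foldl δ v) := fun x hx =>
      ReflTransGen.mono (fun _ _ => lastStep_exits_cons δ) _ _ (ih (δ v a) x hx)
    -- If `u` is never left after the first step, it is the start and its last exit is that step.
    -- Otherwise its last exit lies in the remaining walk.
    by_cases hx : exits δ (δ v a) w u = []
    · have huv : u = v := by
        by_contra h
        exact hu (by rwa [exits_cons_of_ne δ h])
      subst huv
      have hstep : LastStep δ (exits δ u (a :: w)) u (δ u a) :=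
        ⟨a, by rw [exits_cons_self, hx]; rfl, rfl⟩
      cases w with
      | nil => exact ReflTransGen.single hstep
      | cons b w => exact ReflTransGen.head hstep (key _ (by rw [exits_cons_self]; simp))
    · exact key u hx

variable [Fintype V]

/-- The number of entries of the table `T` that lead to `u`. -/
def inCount (T : V → List Ω) (u : V) : ℕ := ∑ x, (T x).countP fun a => δ x a = u

theorem inCount_cons {T T' : V → List Ω} {v : V} {a : Ω} (hv : T v = a :: T' v)
    (hT : ∀ u, u ≠ v → T u = T' u) (u : V) :
    inCount δ T u = inCount δ T' u + if u = δ v a then 1 else 0 := by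
  unfold inCount
  rw [← Finset.add_sum_erase _ _ (mem_univ v), ← Finset.add_sum_erase _ _ (mem_univ v), hv,
    List.countP_cons]
  rw [Finset.sum_congr rfl fun x hx => by rw [hT x (ne_of_mem_erase hx)]]
  simp only [decide_eq_true_eq, eq_comm (a := u)]
  omega

theorem exits_balance (v : V) (w : List Ω) (u : V) :
    (exits δ v w u).length + (if u = w.foldl δ v then 1 else 0) =
      inCount δ (exits δ v w) u + if u = v then 1 else 0 := by
  induction w generalizing v with
  | nil =>
    simp only [exits, inCount, List.countP_nil, List.length_nil, Finset.sum_const_zero]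
    rfl
  | cons a w ih =>
    rw [inCount_cons δ (exits_cons_self δ v a w) fun u hu => exits_cons_of_ne δ hu a w]
    have := ih (δ v a)
    rw [List.foldl_cons]
    by_cases hu : u = v
    · subst hu
      rw [exits_cons_self, List.length_cons, if_pos rfl]
      omega
    · rw [exits_cons_of_ne δ hu, if_neg hu]
      omega

theorem inCount_pos_of_lastStep {T : V → List Ω} {x u : V} (h : LastStep δ T x u) :
    0 < inCount δ T u := by
  obtain ⟨a, ha, rfl⟩ := h
  refine lt_of_lt_of_le ?_ (Finset.single_le_sum (fun _ _ => Nat.zero_le _) (mem_univ x))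
  exact List.countP_pos_iff.2 ⟨a, List.mem_of_getLast? ha, by simp⟩

/-- A balanced table in which last exits lead to `e` is the exit table of a walk. -/
theorem exists_exits_eq (e : V) (T : V → List Ω) (v : V)
    (hflow : ∀ u, (T u).length + (if u = e then 1 else 0) =
      inCount δ T u + if u = v then 1 else 0)
    (htree : ∀ u, T u ≠ [] → ReflTransGen (LastStep δ T) u e) :
    ∃ w, exits δ v w = T := by
  induction hn : ∑ u, (T u).length generalizing T v with
  | zero =>
    refine ⟨[], funext fun u => ?_⟩
    have := (Finset.sum_eq_zero_iff.1 hn) u (mem_univ u)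
    rw [List.length_eq_zero_iff.1 this]; rfl
  | succ n ih =>
    rcases hTv : T v with _ | ⟨a, l⟩
    · exfalso
      have hv := hflow v
      rw [hTv, List.length_nil, if_pos rfl] at hv
      have hve : v = e := by
        by_contra h
        rw [if_neg h] at hv
        omega
      subst hve
      rw [if_pos rfl] at hv
      obtain ⟨u, -, hu⟩ := Finset.exists_ne_zero_of_sum_ne_zero (by rw [hn]; simp :
        ∑ u, (T u).length ≠ 0)
      have hu' : T u ≠ [] := fun h => hu (by simp [h])
      rcases (ReflTransGen.cases_tail (htree u hu')) with h | ⟨x, -, hx⟩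
      · exact hu' (h ▸ hTv)
      · have := inCount_pos_of_lastStep δ hx
        omega
    · set T' := Function.update T v l with hT'
      have hT'v : T' v = l := by simp [T']
      have hT'u : ∀ u, u ≠ v → T u = T' u := fun u hu => by simp [T', hu]
      have hcons : T v = a :: T' v := by rw [hTv, hT'v]
      have hin := inCount_cons δ hcons hT'u
      have hflow' : ∀ u, (T' u).length + (if u = e then 1 else 0) =
          inCount δ T' u + if u = δ v a then 1 else 0 := by
        intro u
        have h1 := hflow u
        rw [hin] at h1
        by_cases hu : u = v
        · subst hu
          rw [hcons, List.length_cons, if_pos rfl] at h1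
          omega
        · rw [hT'u u hu, if_neg hu] at h1
          omega
      have htree' : ∀ u, T' u ≠ [] → ReflTransGen (LastStep δ T') u e := by
        intro u hu
        have hTu : T u ≠ [] := by
          by_cases huv : u = v
          · subst huv; simp [hTv]
          · rwa [hT'u u huv]
        have hstep : ∀ x y, LastStep δ T x y → (x ≠ v ∨ l ≠ []) → LastStep δ T' x y := by
          rintro x y ⟨b, hb, hy⟩ hx
          refine ⟨b, ?_, hy⟩
          by_cases hxv : x = v
          · subst hxv
            rw [hT'v]
            rw [hTv] at hb
            cases l with
            | nil => simp at hx
            | cons c l => rwa [List.getLast?_cons_cons] at hb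
          · rwa [← hT'u x hxv]
        -- Removing the only entry at `v ≠ e` destroys its last exit; by balance nothing leads to
        -- `v` then, so no path from another state passes through it.
        by_cases hl : l = []
        · have huv : u ≠ v := by
            rintro rfl
            exact hu (by rw [hT'v, hl])
          have key : ∀ x, ReflTransGen (LastStep δ T) x e → (x ≠ v ∨ v = e) →
              ReflTransGen (LastStep δ T') x e := by
            intro x hx
            induction hx using ReflTransGen.head_induction_on with
            | refl => exact fun _ => ReflTransGen.refl
            | @head x y hxy _ ih' =>
              intro hxv
              by_cases hx' : x = v
              · have : v = e := by simpa [hx'] using hxv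
                rw [hx', this]
              · refine ReflTransGen.head (hstep _ _ hxy (Or.inl hx')) (ih' ?_)
                by_contra! hcon
                obtain ⟨rfl, hye⟩ := hcon
                have h1 := hflow y
                have h2 := inCount_pos_of_lastStep δ hxy
                simp only [hTv, hl, if_neg hye, List.length_singleton, if_true] at h1
                omega
          exact key u (htree u hTu) (Or.inl huv)
        · exact ReflTransGen.mono (fun x y h => hstep x y h (Or.inr hl)) _ _ (htree u hTu)
      have hsum' : ∑ u, (T' u).length = n := by
        have h1 := Finset.add_sum_erase univ (fun u => (T u).length) (mem_univ v)
        have h2 := Finset.add_sum_erase univ (fun u => (T' u).length) (mem_univ v)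
        rw [Finset.sum_congr rfl fun x hx => by rw [hT'u x (ne_of_mem_erase hx)]] at h1
        simp only [hcons, List.length_cons] at h1
        omega
      obtain ⟨w, hw⟩ := ih T' (δ v a) hflow' htree' hsum'
      refine ⟨a :: w, funext fun u => ?_⟩
      by_cases hu : u = v
      · subst hu; rw [exits_cons_self, hw, hcons]
      · rw [exits_cons_of_ne δ hu, hw, hT'u u hu]

end Walks

/-! ### Counting trees by a determinant -/

section TreeDeterminant

open Matrix

/-- The polynomial det(1 - XB) is a unit, hence constant; compare its values at 0 and 1. -/
theorem Matrix.det_one_sub_of_isNilpotent {V K : Type*} [Fintype V] [DecidableEq V] [Field K]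
    {B : Matrix V V K} (hB : IsNilpotent B) : (1 - B).det = 1 := by
  have h := Matrix.isUnit_charpolyRev_of_isNilpotent hB
  obtain ⟨c, -, hc⟩ := Polynomial.isUnit_iff.1 h
  have h0 : B.charpolyRev.eval 0 = 1 := Matrix.eval_charpolyRev
  have h1 : B.charpolyRev.eval 1 = (1 - B).det := by
    rw [Matrix.charpolyRev, ← Polynomial.coe_evalRingHom, RingHom.map_det]
    congr 1
    ext i j
    simp [Matrix.one_apply, apply_ite]
  rw [← h1, ← h0, ← hc]
  simp

variable {V : Type*} [Fintype V] [DecidableEq V]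

/-- Matrix-tree theorem for a doubly stochastic matrix `P` whose powers reach the uniform matrix:
the principal cofactors of `1 - P` are `1 / |V|`. -/
theorem Matrix.card_mul_det_updateRow_one_sub (P : Matrix V V ℚ) (v : V)
    (hrow : ∀ u, ∑ x, P u x = 1) (hcol : ∀ x, ∑ u, P u x = 1)
    (n : ℕ) (hP : ∀ u x, (P ^ n) u x = 1 / (Fintype.card V : ℚ)) :
    (Fintype.card V : ℚ) * ((1 - P).updateRow v (Pi.single v 1)).det = 1 := by
  set N : ℚ := (Fintype.card V : ℚ) with hN
  have hN0 : N ≠ 0 := by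
    have : Nonempty V := ⟨v⟩
    simp [hN]
  set J : Matrix V V ℚ := Matrix.of fun _ _ => 1 / N with hJ
  have hPn : P ^ n = J := by ext u x; simp [hP, hJ]
  have hPJ : P * J = J := by
    ext u x
    simp only [Matrix.mul_apply, hJ, Matrix.of_apply, ← Finset.sum_mul, hrow, one_mul]
  have hJP : J * P = J := by
    ext u x
    simp only [Matrix.mul_apply, hJ, Matrix.of_apply, ← Finset.mul_sum, hcol, mul_one]
  have hJJ : J * J = J := by
    ext u x
    simp [Matrix.mul_apply, hJ, ← hN]
    field_simp
  have hpow : ∀ i, (P - J) ^ (i + 1) = P ^ (i + 1) - J := by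
    intro i
    induction i with
    | zero => simp
    | succ i ih =>
      have hPi : P ^ (i + 1) * J = J := by
        clear ih
        induction i with
        | zero => simpa using hPJ
        | succ i ih => rw [pow_succ, mul_assoc, hPJ, ih]
      rw [pow_succ, ih, sub_mul, mul_sub, mul_sub, hPi, hJP, hJJ, ← pow_succ]
      abel
  -- The exponent is `n + 1` because `hpow` covers only positive exponents and `n` may be 0.
  have hnil : IsNilpotent (P - J) := by
    refine ⟨n + 1, ?_⟩
    rw [hpow, pow_succ, hPn, hJP, sub_self]
  have h1 := Matrix.det_one_sub_of_isNilpotent hnil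
  -- Adding all rows to row `v` makes it constant 1; in `h3`, multiples of that row then remove `J`
  -- from the others.
  have h2 : ((1 - (P - J)).updateRow v fun _ => 1).det = 1 := by
    have := Matrix.det_updateRow_sum (1 - (P - J)) v (fun _ => 1)
    rw [h1] at this
    simp only [one_smul] at this
    refine Eq.trans ?_ this
    congr 2
    ext x
    have hs : ∑ u, (1 - (P - J)) u x = 1 := by
      simp [Finset.sum_sub_distrib, hcol, hJ, Matrix.one_apply, ← hN, hN0]
    exact hs.symm.trans (Finset.sum_apply x _ _).symm
  have h3 : ((1 - P).updateRow v fun _ => 1).det = 1 := by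
    refine Eq.trans (Eq.symm ?_) h2
    refine Matrix.det_eq_of_forall_row_eq_smul_add_const
      (fun i => if i = v then 0 else 1 / N) v (by simp) ?_
    intro i j
    by_cases hi : i = v
    · subst hi; simp
    · simp [hi, hJ]
      ring
  set Y := (1 - P).updateRow v fun _ => 1 with hY
  set X := (1 - P).updateRow v (Pi.single v 1) with hX
  -- Adding all columns to column `v`: the rows of `1 - P` sum to 0 and the row of ones sums to `N`.
  have hYsum : (Y.updateCol v (Pi.single v N)).det = 1 := by
    have := Matrix.det_updateCol_sum Y v (fun _ => 1)
    rw [h3] at this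
    simp only [one_smul] at this
    refine Eq.trans ?_ this
    congr 2
    ext x
    by_cases hx : x = v
    · subst hx; simp [hY, hN]
    · simp [hY, hx, Finset.sum_sub_distrib, hrow, Matrix.one_apply]
  have hXsum : (X.updateCol v (Pi.single v 1)).det = X.det := by
    have := Matrix.det_updateCol_sum X v (fun _ => 1)
    simp only [one_smul] at this
    rw [← this]
    congr 2
    ext x
    by_cases hx : x = v
    · subst hx; simp [hX]
    · simp [hX, hx, Finset.sum_sub_distrib, hrow, Matrix.one_apply]
  -- With column `v` a unit vector, subtracting it from the other columns clears the rest of row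
  -- `v`, the only place where `X` and `Y` differ.
  have hXY : (Y.updateCol v (Pi.single v 1)).det = (X.updateCol v (Pi.single v 1)).det := by
    rw [← Matrix.det_transpose, ← Matrix.det_transpose (X.updateCol _ _)]
    refine Matrix.det_eq_of_forall_row_eq_smul_add_const
      (fun j => if j = v then 0 else 1) v (by simp) ?_
    intro j i
    by_cases hj : j = v
    · subst hj; simp
    · by_cases hi : i = v
      · subst hi; simp [hj, hX, hY]
      · simp [hj, hi, hX, hY]
  rw [← hXsum, ← hXY, ← Matrix.det_updateCol_smul]
  refine Eq.trans ?_ hYsum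
  congr 2
  ext x
  by_cases hx : x = v
  · subst hx; simp
  · simp [hx]

/-- The successor map `f`, killed at `v`. -/
def killedStep (f : V → V) (v : V) : Matrix V V ℚ :=
  Matrix.of fun u x => if u ≠ v ∧ x = f u then 1 else 0

omit [Fintype V] in
theorem killedStep_self (f : V → V) (v x : V) : killedStep f v v x = 0 := by
  simp [killedStep]

theorem killedStep_mul_apply (f : V → V) {u v : V} (hu : u ≠ v) {W : Type*}
    (M : Matrix V W ℚ) (x : W) : (killedStep f v * M) u x = M (f u) x := by
  simp [Matrix.mul_apply, killedStep, hu]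

/-- Every orbit is killed on reaching `v`, so the matrix is nilpotent. -/
theorem det_one_sub_killedStep_of_reach (f : V → V) (v : V)
    (h : ∀ u, ReflTransGen (fun x y => f x = y) u v) : (1 - killedStep f v).det = 1 := by
  apply Matrix.det_one_sub_of_isNilpotent
  have hrow : ∀ u, ∃ i, ∀ x, (killedStep f v ^ i) u x = 0 := by
    intro u
    induction h u using ReflTransGen.head_induction_on with
    | refl => exact ⟨1, fun x => by rw [pow_one, killedStep_self]⟩
    | @head u y hxy _ ih =>
      obtain ⟨i, hi⟩ := ih
      by_cases hu : u = v
      · exact ⟨1, fun x => by rw [pow_one, hu, killedStep_self]⟩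
      · refine ⟨i + 1, fun x => ?_⟩
        rw [pow_succ', killedStep_mul_apply f hu, hxy, hi]
  choose i hi using hrow
  refine ⟨∑ u, i u, ?_⟩
  ext u x
  rw [← Finset.add_sum_erase _ _ (mem_univ u), pow_add, Matrix.mul_apply]
  simp [hi]

/-- The indicator of the states that never reach `v` lies in the kernel. -/
theorem det_one_sub_killedStep_of_not_reach (f : V → V) (v : V)
    (h : ¬ ∀ u, ReflTransGen (fun x y => f x = y) u v) : (1 - killedStep f v).det = 0 := by
  classical
  push Not at h
  obtain ⟨u₀, hu₀⟩ := h
  rw [← Matrix.exists_mulVec_eq_zero_iff]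
  refine ⟨fun u => if ReflTransGen (fun x y => f x = y) u v then 0 else 1, ?_, ?_⟩
  · intro h0
    simpa [hu₀] using congrFun h0 u₀
  · ext u
    rw [Matrix.sub_mulVec, Matrix.one_mulVec, Pi.sub_apply, Pi.zero_apply, sub_eq_zero]
    by_cases hu : u = v
    · subst hu
      simp [Matrix.mulVec, dotProduct, killedStep_self, ReflTransGen.refl]
    · have hiff : ReflTransGen (fun x y => f x = y) u v ↔
          ReflTransGen (fun x y => f x = y) (f u) v := by
        constructor
        · intro h
          rcases ReflTransGen.cases_head h with h | ⟨x, rfl, hx⟩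
          · exact absurd h hu
          · exact hx
        · exact fun h => ReflTransGen.head rfl h
      simp only [Matrix.mulVec, dotProduct, killedStep, hiff, Matrix.of_apply, ite_mul, one_mul,
        zero_mul]
      simp [hu]

variable {Ω : Type*} [Fintype Ω]

/-- The transition matrix of the random walk with uniform letters. -/
def transition (δ : V → Ω → V) : Matrix V V ℚ :=
  Matrix.of fun u x => ∑ a, if x = δ u a then 1 / (Fintype.card Ω : ℚ) else 0

open Classical in
/-- The number of choices of one letter at each state whose steps all lead to `v`. -/
theorem card_reach_eq_det (δ : V → Ω → V) (v : V) [Nonempty Ω] :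
    (((univ : Finset (V → Ω)).filter fun g =>
      ∀ u, ReflTransGen (fun x y => δ x (g x) = y) u v).card : ℚ) =
    (Fintype.card Ω : ℚ) ^ Fintype.card V *
      ((1 - transition δ).updateRow v (Pi.single v 1)).det := by
  have hq : (Fintype.card Ω : ℚ) ≠ 0 := by simp
  -- Each row is an average over letters, so multilinearity expands the determinant over all choices
  -- `g`. Row `v` is written as an average too, since `g` also chooses a letter there.
  have hrows : (1 - transition δ).updateRow v (Pi.single v 1) =
      fun u => ∑ a, (1 / (Fintype.card Ω : ℚ)) •
        ((1 : Matrix V V ℚ) u - if u = v then 0 else Pi.single (δ u a) 1) := by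
    ext u x
    rw [Finset.sum_apply]
    by_cases hu : u = v
    · subst hu
      simp [hq, Matrix.one_apply, Pi.single_apply, eq_comm]
    · simp [hu, transition, Matrix.sub_apply, mul_sub, Finset.sum_sub_distrib, hq, Pi.single_apply]
  rw [hrows]
  have hsum := (Matrix.detRowAlternating (n := V) (R := ℚ)).toMultilinearMap.map_sum
    (fun u (a : Ω) => (1 / (Fintype.card Ω : ℚ)) •
        ((1 : Matrix V V ℚ) u - if u = v then 0 else Pi.single (δ u a) 1))
  change _ = _ * Matrix.detRowAlternating.toMultilinearMap _
  rw [hsum, Finset.mul_sum, Finset.card_filter, Nat.cast_sum]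
  refine Finset.sum_congr rfl fun g _ => ?_
  rw [MultilinearMap.map_smul_univ, Finset.prod_const, card_univ, smul_eq_mul, ← mul_assoc,
    ← mul_pow, mul_one_div_cancel hq, one_pow, one_mul]
  have hmat : (Matrix.of fun u => (1 : Matrix V V ℚ) u - if u = v then 0 else Pi.single (δ u (g u)) 1) =
      1 - killedStep (fun u => δ u (g u)) v := by
    ext u x
    by_cases hu : u = v
    · subst hu; simp [Matrix.sub_apply, killedStep]
    · simp [Matrix.sub_apply, killedStep, hu, Pi.single_apply]
  change _ = Matrix.det (Matrix.of fun u =>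
    (1 : Matrix V V ℚ) u - if u = v then 0 else Pi.single (δ u (g u)) 1)
  rw [hmat]
  split_ifs with h
  · rw [det_one_sub_killedStep_of_reach _ _ h, Nat.cast_one]
  · rw [det_one_sub_killedStep_of_not_reach _ _ h, Nat.cast_zero]

end TreeDeterminant

/-! ### Words with prescribed letter counts and last letter -/

section Arrangements

variable {Ω : Type*} [Fintype Ω] [DecidableEq Ω]

theorem List.countP_eq_sum_count (p : Ω → Prop) [DecidablePred p] (l : List Ω) :
    l.countP p = ∑ a, if p a then l.count a else 0 := by
  induction l with
  | nil => simp
  | cons b l ih =>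
    simp only [List.countP_cons, ih, List.count_cons, beq_iff_eq, decide_eq_true_eq]
    have h : ∀ a, (if p a then l.count a + (if b = a then 1 else 0) else 0) =
        (if p a then l.count a else 0) + if b = a then (if p b then 1 else 0) else 0 := by
      intro a
      by_cases h1 : p a <;> by_cases h2 : b = a <;> simp_all
    simp [h, Finset.sum_add_distrib]

theorem List.length_eq_sum_count (l : List Ω) : l.length = ∑ a, l.count a := by
  have := List.countP_eq_sum_count (fun _ => True) l
  simpa using this

theorem finite_setOf_count_eq (c : Ω → ℕ) : {l : List Ω | ∀ a, l.count a = c a}.Finite := by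
  refine (List.finite_length_eq Ω (∑ a, c a)).subset fun l hl => ?_
  rw [Set.mem_ofPred_eq, List.length_eq_sum_count]
  exact Finset.sum_congr rfl fun a _ => hl a

/-- The words in which each letter `a` occurs `c a` times. -/
noncomputable def arrangements (c : Ω → ℕ) : Finset (List Ω) := (finite_setOf_count_eq c).toFinset

theorem mem_arrangements {c : Ω → ℕ} {l : List Ω} :
    l ∈ arrangements c ↔ ∀ a, l.count a = c a := by
  simp [arrangements]

/-- The words in `arrangements c` whose last letter is `a`. -/
noncomputable def arrangementsEnding (c : Ω → ℕ) (a : Ω) : Finset (List Ω) :=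
  (arrangements c).filter fun l => l.getLast? = some a

theorem mem_arrangementsEnding {c : Ω → ℕ} {a : Ω} {l : List Ω} :
    l ∈ arrangementsEnding c a ↔ (∀ b, l.count b = c b) ∧ l.getLast? = some a := by
  simp [arrangementsEnding, mem_arrangements]

theorem card_arrangementsEnding_add_single (c : Ω → ℕ) (a : Ω) :
    (arrangementsEnding (c + Pi.single a 1) a).card = (arrangements c).card := by
  symm
  refine Finset.card_bij (fun l _ => l ++ [a]) ?_ ?_ ?_
  · intro l hl
    rw [mem_arrangements] at hl
    rw [mem_arrangementsEnding]
    refine ⟨fun b => ?_, by simp⟩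
    rw [List.count_append, hl, List.count_singleton, Pi.add_apply, Pi.single_apply]
    simp only [beq_iff_eq, eq_comm (a := a)]
  · intro l _ l' _ h
    exact List.append_cancel_right h
  · intro l hl
    rw [mem_arrangementsEnding] at hl
    obtain ⟨h, hlast⟩ := hl
    obtain ⟨l', rfl⟩ := List.getLast?_eq_some_iff.1 hlast
    refine ⟨l', ?_, rfl⟩
    rw [mem_arrangements]
    intro b
    have := h b
    simp only [List.count_append, List.count_singleton, Pi.add_apply, Pi.single_apply,
      beq_iff_eq] at this
    simp only [eq_comm (a := a)] at this
    omega

theorem prod_factorial_add_single (c : Ω → ℕ) (a : Ω) :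
    ∏ b, ((c + Pi.single a 1 : Ω → ℕ) b).factorial = (c a + 1) * ∏ b, (c b).factorial := by
  rw [← Finset.mul_prod_erase _ _ (mem_univ a),
    ← Finset.mul_prod_erase _ (fun b => (c b).factorial) (mem_univ a), ← mul_assoc]
  congr 1
  · simp [Nat.factorial_succ]
  · exact Finset.prod_congr rfl fun b hb => by simp [ne_of_mem_erase hb]

/-- Induction on the length, splitting by the last letter and deleting it. -/
theorem card_arrangements_mul (c : Ω → ℕ) :
    (arrangements c).card * ∏ a, (c a).factorial = (∑ a, c a).factorial := by
  induction hS : ∑ a, c a generalizing c with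
  | zero =>
    have hc : ∀ a, c a = 0 := fun a => (Finset.sum_eq_zero_iff.1 hS) a (mem_univ a)
    have : arrangements c = {[]} := by
      ext l
      rw [mem_arrangements, mem_singleton]
      constructor
      · intro h
        rw [← List.length_eq_zero_iff, List.length_eq_sum_count, ← hS]
        exact Finset.sum_congr rfl fun a _ => h a
      · rintro rfl a
        simp [hc]
    simp [this, hc]
  | succ S ih =>
    have hlast : ∀ a, (arrangementsEnding c a).card * ∏ b, (c b).factorial =
        c a * S.factorial := by
      intro a
      rcases Nat.eq_zero_or_pos (c a) with h0 | hpos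
      · have : arrangementsEnding c a = ∅ := by
          ext l
          simp only [mem_arrangementsEnding, notMem_empty, iff_false, not_and]
          intro h hl
          have := List.count_pos_iff.2 (List.mem_of_getLast? hl)
          rw [h, h0] at this
          omega
        simp [this, h0]
      · obtain ⟨c', rfl⟩ : ∃ c' : Ω → ℕ, c = c' + Pi.single a 1 := by
          refine ⟨c - Pi.single a 1, (tsub_add_cancel_of_le ?_).symm⟩
          intro b
          by_cases hb : b = a
          · subst hb; simpa using Nat.succ_le_of_lt hpos
          · simp [hb]
        have hS' : ∑ b, c' b = S := by
          have : ∑ b, (c' b + (Pi.single a 1 : Ω → ℕ) b) = S + 1 := hS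
          rw [Finset.sum_add_distrib] at this
          simpa using this
        rw [card_arrangementsEnding_add_single, prod_factorial_add_single, ← mul_assoc,
          mul_right_comm, ih c' hS', Pi.add_apply, Pi.single_eq_same]
        ring
    have hcard : (arrangements c).card = ∑ a, (arrangementsEnding c a).card := by
      rw [Finset.card_eq_sum_card_fiberwise (f := List.getLast?) (t := univ)
        (fun _ _ => mem_coe.2 (mem_univ _)), Fintype.sum_option]
      have : ((arrangements c).filter fun l => l.getLast? = none) = ∅ := by
        ext l
        simp only [mem_filter, mem_arrangements, List.getLast?_eq_none_iff, notMem_empty,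
          iff_false, not_and]
        rintro h rfl
        have : ∑ a, c a = 0 := Finset.sum_eq_zero fun a _ => by rw [← h a]; simp
        omega
      rw [this, card_empty, zero_add]
      rfl
    rw [hcard, Finset.sum_mul, Finset.sum_congr rfl fun a _ => hlast a, ← Finset.sum_mul, hS,
      Nat.factorial_succ]

theorem card_arrangementsEnding_mul (c : Ω → ℕ) (a : Ω) (h : 0 < c a) :
    (arrangementsEnding c a).card * ∏ b, (c b).factorial =
      c a * (∑ b, c b - 1).factorial := by
  obtain ⟨c', rfl⟩ : ∃ c' : Ω → ℕ, c = c' + Pi.single a 1 := by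
    refine ⟨c - Pi.single a 1, (tsub_add_cancel_of_le ?_).symm⟩
    intro b
    by_cases hb : b = a
    · subst hb; simpa using Nat.succ_le_of_lt h
    · simp [hb]
  have hS' : ∑ b, (c' + Pi.single a 1 : Ω → ℕ) b = ∑ b, c' b + 1 := by
    simp [Finset.sum_add_distrib]
  rw [card_arrangementsEnding_add_single, prod_factorial_add_single, ← mul_assoc,
    mul_right_comm, card_arrangements_mul, hS', Pi.add_apply, Pi.single_eq_same,
    Nat.add_sub_cancel, mul_comm]

theorem card_arrangementsEnding_const (m : ℕ) (hm : 0 < m) (a : Ω) :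
    ((arrangementsEnding (fun _ : Ω => m) a).card : ℚ) =
      ((m * Fintype.card Ω).factorial : ℚ) / (m.factorial : ℚ) ^ Fintype.card Ω /
        Fintype.card Ω := by
  have h := card_arrangementsEnding_mul (fun _ : Ω => m) a hm
  have : Nonempty Ω := ⟨a⟩
  have hq : 0 < Fintype.card Ω := Fintype.card_pos
  simp only [prod_const, sum_const, card_univ, smul_eq_mul] at h
  have h2 := Nat.mul_factorial_pred (Nat.mul_pos hq hm).ne'
  have h3 : ((arrangementsEnding (fun _ : Ω => m) a).card * m.factorial ^ Fintype.card Ω) *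
      Fintype.card Ω = (m * Fintype.card Ω).factorial := by
    rw [h, mul_comm m (Fintype.card Ω), ← h2]
    ring
  rw [div_div, eq_div_iff (by positivity), ← mul_assoc]
  exact_mod_cast h3

end Arrangements

/-! ### The BEST-type count of closed walks -/

section CountWalks

variable {V Ω : Type*} [Fintype V] [DecidableEq V] [Fintype Ω] [DecidableEq Ω] (δ : V → Ω → V)

theorem inCount_of_count_eq {m : ℕ} {T : V → List Ω} (hT : ∀ u a, (T u).count a = m)
    (hin : ∀ u, ∑ x, ∑ a, (if δ x a = u then 1 else 0) = Fintype.card Ω) (u : V) :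
    inCount δ T u = (T u).length := by
  rw [inCount, List.length_eq_sum_count]
  simp only [List.countP_eq_sum_count, hT, sum_const, card_univ, smul_eq_mul]
  rw [← hin u, Finset.sum_mul]
  refine Finset.sum_congr rfl fun x _ => ?_
  rw [Finset.sum_mul]
  exact Finset.sum_congr rfl fun a _ => by split_ifs <;> simp

/-- Equal in- and out-counts at every state leave no room for an end different from the start. -/
theorem foldl_eq_of_count_exits {m : ℕ} {v : V} {w : List Ω}
    (hw : ∀ u a, (exits δ v w u).count a = m)
    (hin : ∀ u, ∑ x, ∑ a, (if δ x a = u then 1 else 0) = Fintype.card Ω) :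
    w.foldl δ v = v := by
  have h := exits_balance δ v w v
  rw [inCount_of_count_eq δ hw hin, if_pos rfl] at h
  by_contra hne
  rw [if_neg (Ne.symm hne)] at h
  omega

open Classical in
theorem image_exits_eq {m : ℕ} (hm : 0 < m) [Nonempty Ω] (v : V)
    (hin : ∀ u, ∑ x, ∑ a, (if δ x a = u then 1 else 0) = Fintype.card Ω) :
    exits δ v '' {w | ∀ u a, (exits δ v w u).count a = m} =
      (((univ : Finset (V → Ω)).filter fun g =>
        ∀ u, ReflTransGen (fun x y => δ x (g x) = y) u v).biUnion fun g =>
          Fintype.piFinset fun u => arrangementsEnding (fun _ => m) (g u) :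
        Finset (V → List Ω)) := by
  have hrel : ∀ (T : V → List Ω) (g : V → Ω), (∀ u, (T u).getLast? = some (g u)) →
      LastStep δ T = fun x y => δ x (g x) = y := by
    intro T g h
    ext x y
    simp [LastStep, h]
  ext T
  simp only [Set.mem_image, Set.mem_ofPred_eq, coe_biUnion, coe_filter, mem_univ, true_and,
    Set.mem_iUnion, mem_coe, Fintype.mem_piFinset, mem_arrangementsEnding, exists_prop]
  constructor
  · rintro ⟨w, hw, rfl⟩
    have hne : ∀ u, exits δ v w u ≠ [] := by
      intro u h
      have := hw u (Classical.arbitrary Ω)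
      rw [h, List.count_nil] at this
      omega
    have hlast : ∀ u, (exits δ v w u).getLast? = some ((exits δ v w u).getLast (hne u)) :=
      fun u => List.getLast?_eq_getLast_of_ne_nil (hne u)
    refine ⟨fun u => (exits δ v w u).getLast (hne u), fun u => ?_, fun u => ⟨hw u, hlast u⟩⟩
    rw [← hrel _ _ hlast]
    have := reflTransGen_lastStep_exits δ v w u (hne u)
    rwa [foldl_eq_of_count_exits δ hw hin] at this
  · rintro ⟨g, hg, hT⟩
    have hcount : ∀ u a, (T u).count a = m := fun u => (hT u).1
    obtain ⟨w, rfl⟩ := exists_exits_eq δ v T v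
      (fun u => by rw [inCount_of_count_eq δ hcount hin])
      (fun u _ => by rw [hrel _ _ fun u => (hT u).2]; exact hg u)
    exact ⟨w, hcount, rfl⟩

open Classical in
/-- The number of closed walks from `v` that use each edge `m` times. -/
theorem ncard_walks {m : ℕ} (hm : 0 < m) [Nonempty Ω] (v : V)
    (hin : ∀ u, ∑ x, ∑ a, (if δ x a = u then 1 else 0) = Fintype.card Ω)
    (n : ℕ) (hP : ∀ u x, (transition δ ^ n) u x = 1 / (Fintype.card V : ℚ)) :
    (Set.ncard {w | ∀ u a, (exits δ v w u).count a = m} : ℚ) =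
      (((m * Fintype.card Ω).factorial : ℚ) / (m.factorial : ℚ) ^ Fintype.card Ω) ^
        Fintype.card V / Fintype.card V := by
  have hq : (Fintype.card Ω : ℚ) ≠ 0 := by simp
  have : Nonempty V := ⟨v⟩
  have hN : (Fintype.card V : ℚ) ≠ 0 := by simp
  rw [← Set.ncard_image_of_injective _ (exits_injective δ v), image_exits_eq δ hm v hin,
    Set.ncard_coe_finset, Finset.card_biUnion]
  · simp only [Fintype.card_piFinset, Nat.cast_sum, Nat.cast_prod,
      card_arrangementsEnding_const m hm, prod_const, card_univ, sum_const, nsmul_eq_mul]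
    -- The factor q^|V| here cancels the 1/q contributed by each state's prescribed last letter; the
    -- determinant is 1/|V|.
    rw [card_reach_eq_det δ v]
    have hrow : ∀ u, ∑ x, transition δ u x = 1 := by
      intro u
      simp only [transition, Matrix.of_apply]
      rw [Finset.sum_comm]
      simp [hq]
    have hcol : ∀ x, ∑ u, transition δ u x = 1 := by
      intro x
      have h := congrArg (fun z : ℕ => (z : ℚ) * (1 / Fintype.card Ω)) (hin x)
      simp only [mul_one_div_cancel hq] at h
      rw [← h]
      simp only [transition, Matrix.of_apply, Nat.cast_sum, Finset.sum_mul]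
      exact Finset.sum_congr rfl fun u _ => Finset.sum_congr rfl fun a _ => by
        simp [eq_comm]
    have hdet := Matrix.card_mul_det_updateRow_one_sub (transition δ) v hrow hcol n hP
    rw [eq_div_iff hN, div_pow _ (Fintype.card Ω : ℚ), mul_assoc, mul_comm _ (Fintype.card V : ℚ)]
    field_simp
    linear_combination hdet
  · intro g _ g' _ hne
    rw [Function.onFun, Finset.disjoint_left]
    intro T hT hT'
    apply hne
    ext u
    simp only [Fintype.mem_piFinset, mem_arrangementsEnding] at hT hT'
    exact Option.some.inj ((hT u).2.symm.trans (hT' u).2)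

end CountWalks

namespace MultiDeBruijn

/-! ### The de Bruijn graph on n-mers -/

section Shift

variable {Ω : Type*} {n : ℕ}

/-- The step of the de Bruijn graph on `n`-mers. -/
def shift (u : Fin n → Ω) (a : Ω) : Fin n → Ω := Fin.tail (Fin.snoc u a : Fin (n + 1) → Ω)

theorem shift_apply (u : Fin n → Ω) (a : Ω) (j : Fin n) :
    shift u a j = if h : (j : ℕ) + 1 < n then u ⟨j + 1, h⟩ else a := by
  simp [shift, Fin.tail, Fin.snoc, Fin.castLT]

theorem ofFn_snoc (u : Fin n → Ω) (a : Ω) :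
    List.ofFn (Fin.snoc u a : Fin (n + 1) → Ω) = List.ofFn u ++ [a] := by
  rw [List.ofFn_succ']
  simp [List.concat_eq_append]

theorem ofFn_shift_append (u : Fin n → Ω) (a : Ω) (w : List Ω) :
    List.ofFn (shift u a) ++ w = (List.ofFn u ++ a :: w).tail := by
  have h : List.ofFn (Fin.snoc u a : Fin (n + 1) → Ω) =
      (Fin.snoc u a : Fin (n + 1) → Ω) 0 :: List.ofFn (shift u a) := by
    rw [List.ofFn_succ]; rfl
  have h2 : List.ofFn u ++ a :: w = List.ofFn (Fin.snoc u a : Fin (n + 1) → Ω) ++ w := by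
    rw [ofFn_snoc]; simp
  rw [h2, h]; rfl

theorem ofFn_foldl_shift (v : Fin n → Ω) (w : List Ω) :
    List.ofFn (w.foldl shift v) = (List.ofFn v ++ w).drop w.length := by
  induction w generalizing v with
  | nil => simp
  | cons a w ih =>
    rw [List.foldl_cons, ih, ofFn_shift_append, List.drop_tail, List.length_cons]

variable [Fintype Ω] [DecidableEq Ω]

/-- The edges into `u` are the (n+1)-mers `b u`, one for each letter `b`. -/
theorem sum_shift_eq (u : Fin n → Ω) :
    ∑ x, ∑ a, (if shift x a = u then 1 else 0) = Fintype.card Ω := by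
  rw [← Fintype.sum_prod_type' (f := fun x a => if shift x a = u then 1 else 0),
    ← Finset.card_filter, ← Finset.card_univ (α := Ω)]
  symm
  refine Finset.card_bij
    (fun b _ => (Fin.init (Fin.cons b u : Fin (n + 1) → Ω),
      (Fin.cons b u : Fin (n + 1) → Ω) (Fin.last n))) ?_ ?_ ?_
  · intro b _
    refine mem_filter.2 ⟨mem_univ _, ?_⟩
    rw [shift, Fin.snoc_init_self, Fin.tail_cons]
  · intro b _ b' _ h
    have h1 : (Fin.cons b u : Fin (n + 1) → Ω) = Fin.cons b' u := by
      rw [← Fin.snoc_init_self (Fin.cons b u : Fin (n + 1) → Ω),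
        ← Fin.snoc_init_self (Fin.cons b' u : Fin (n + 1) → Ω)]
      rw [Prod.mk.injEq] at h
      rw [h.1, h.2]
    simpa using congrFun h1 0
  · rintro ⟨x, a⟩ hxa
    simp only [mem_filter, mem_univ, true_and] at hxa
    refine ⟨(Fin.snoc x a : Fin (n + 1) → Ω) 0, mem_univ _, ?_⟩
    have : (Fin.cons ((Fin.snoc x a : Fin (n + 1) → Ω) 0) u : Fin (n + 1) → Ω) = Fin.snoc x a := by
      rw [← hxa, shift, Fin.cons_self_tail]
    rw [this]
    simp

omit [DecidableEq Ω] in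
theorem transition_mul_apply {V : Type*} [Fintype V] [DecidableEq V] (δ : V → Ω → V)
    (M : Matrix V V ℚ) (u x : V) :
    (transition δ * M) u x = ∑ a, 1 / (Fintype.card Ω : ℚ) * M (δ u a) x := by
  simp only [Matrix.mul_apply, transition, Matrix.of_apply, Finset.sum_mul]
  rw [Finset.sum_comm]
  simp

/-- After `i` steps the first `n - i` letters are the last ones of `u` and the other `i` are
uniform. For `i = n` the condition is empty. -/
theorem transition_shift_pow [Nonempty Ω] (i : ℕ) (hi : i ≤ n) (u x : Fin n → Ω) :
    (transition shift ^ i) u x =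
      if ∀ j : Fin n, ∀ h : i + j < n, u ⟨i + j, h⟩ = x j then
        1 / (Fintype.card Ω : ℚ) ^ i else 0 := by
  induction i generalizing u with
  | zero =>
    simp [Matrix.one_apply, funext_iff]
  | succ i ih =>
    rw [pow_succ', transition_mul_apply]
    have hcond : ∀ a, (∀ j : Fin n, ∀ h : i + j < n, shift u a ⟨i + j, h⟩ = x j) ↔
        (a = x ⟨n - 1 - i, by omega⟩ ∧
          ∀ j : Fin n, ∀ h : i + 1 + j < n, u ⟨i + 1 + j, h⟩ = x j) := by
      intro a
      constructor
      · intro h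
        refine ⟨?_, fun j hj => ?_⟩
        · have := h ⟨n - 1 - i, by omega⟩ (by simp only; omega)
          rw [shift_apply, dif_neg (by simp only; omega)] at this
          exact this
        · have := h j (by omega)
          rw [shift_apply, dif_pos (by simp only; omega)] at this
          rw [← this]
          congr 2
          simp only; omega
      · rintro ⟨rfl, h⟩ j hj
        rw [shift_apply]
        split_ifs with h1
        · rw [← h j (by change i + (j : ℕ) + 1 < n at h1; omega)]
          congr 2
          simp only; omega
        · congr 2
          simp only at h1
          omega
    simp only [ih (by omega), hcond]
    by_cases hc : ∀ j : Fin n, ∀ h : i + 1 + j < n, u ⟨i + 1 + j, h⟩ = x j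
    · simp only [hc, implies_true, and_true, if_true]
      simp [pow_succ, mul_comm]
    · simp [hc]

end Shift

/-! ### Linearizations as closed walks -/

section Linearizations

variable {Ω : Type*} [DecidableEq Ω]

omit [DecidableEq Ω] in
theorem getElem?_rotate_mod (s : List Ω) (i j : ℕ) :
    (s.rotate i)[j % (s.rotate i).length]? = s[(i + j) % s.length]? := by
  rcases Nat.eq_zero_or_pos s.length with h | h
  · rw [List.length_eq_zero_iff.1 h]; simp
  · rw [List.length_rotate, List.getElem?_rotate (Nat.mod_lt _ h), Nat.mod_add_mod, add_comm]

omit [DecidableEq Ω] in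
theorem startsWith_rotate_iff {k : ℕ} (s : List Ω) (i : ℕ) (y : Fin k → Ω) :
    StartsWith (s.rotate i) y ↔ ∀ j : Fin k, s[(i + j) % s.length]? = some (y j) := by
  simp only [StartsWith, getElem?_rotate_mod]

theorem mem_LC_iff {m k : ℕ} {s : List Ω} : s ∈ LC Ω m k ↔ ∀ y : Fin k → Ω, occ s y = m :=
  Iff.rfl

/-- Reading `a` at state `u` is an occurrence of the (n+1)-mer `u a` in the text `v w`. -/
theorem count_exits_shift {n : ℕ} (v : Fin n → Ω) (w : List Ω) (u : Fin n → Ω) (a : Ω) :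
    (exits shift v w u).count a = ((range w.length).filter fun i =>
      ∀ j : Fin (n + 1), (List.ofFn v ++ w)[i + (j : ℕ)]? =
        some ((Fin.snoc u a : Fin (n + 1) → Ω) j)).card := by
  induction w generalizing v with
  | nil => simp [exits]
  | cons b w ih =>
    rw [List.length_cons, Finset.card_filter, Finset.sum_range_succ', ← Finset.card_filter]
    have hstep : ∀ i j, (List.ofFn v ++ b :: w)[i + 1 + j]? =
        (List.ofFn (shift v b) ++ w)[i + j]? := by
      intro i j
      rw [ofFn_shift_append, List.getElem?_tail]
      congr 1
      omega
    have hzero : (∀ j : Fin (n + 1), (List.ofFn v ++ b :: w)[0 + (j : ℕ)]? =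
        some ((Fin.snoc u a : Fin (n + 1) → Ω) j)) ↔ u = v ∧ b = a := by
      rw [Fin.forall_fin_succ']
      refine and_congr ?_ ?_
      · rw [funext_iff]
        refine forall_congr' fun j => ?_
        rw [List.getElem?_append_left (by simp)]
        simp [eq_comm]
      · rw [List.getElem?_append_right (by simp)]
        simp
    simp only [hstep, hzero, ← ih]
    by_cases hu : u = v
    · subst hu
      rw [exits_cons_self, List.count_cons]
      simp
    · rw [exits_cons_of_ne _ hu]
      simp [hu]

theorem occ_snoc_eq_count_exits {n : ℕ} {v : Fin n → Ω} {s w : List Ω}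
    (hlen : w.length = s.length)
    (h : ∀ t < n + w.length, (List.ofFn v ++ w)[t]? = s[t % s.length]?)
    (u : Fin n → Ω) (a : Ω) :
    occ s (Fin.snoc u a : Fin (n + 1) → Ω) = (exits shift v w u).count a := by
  rw [count_exits_shift, occ, hlen]
  congr 1
  refine Finset.filter_congr fun i hi => ?_
  rw [startsWith_rotate_iff]
  refine forall_congr' fun j => ?_
  rw [h]
  have := j.2
  rw [mem_range] at hi
  omega

theorem forall_occ_eq_iff {n m : ℕ} {v : Fin n → Ω} {s w : List Ω}
    (hlen : w.length = s.length)
    (h : ∀ t < n + w.length, (List.ofFn v ++ w)[t]? = s[t % s.length]?) :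
    (∀ y : Fin (n + 1) → Ω, occ s y = m) ↔ ∀ u a, (exits shift v w u).count a = m := by
  constructor
  · intro hs u a
    rw [← occ_snoc_eq_count_exits hlen h, hs]
  · intro hw y
    rw [← Fin.snoc_init_self y, occ_snoc_eq_count_exits hlen h, hw]

variable [Fintype Ω]

/-- The start state already carries the first `n` letters, so the walk reads `s` from position `n`
on, cyclically. -/
theorem image_rotate_startsWith {n m : ℕ} (hm : 0 < m) [Nonempty Ω] (v : Fin n → Ω) :
    (fun s : List Ω => s.rotate n) '' {s ∈ LC Ω m (n + 1) | StartsWith s v} =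
      {w | ∀ u a, (exits shift v w u).count a = m} := by
  ext w
  simp only [Set.mem_image, Set.mem_ofPred_eq]
  constructor
  · rintro ⟨s, ⟨hs, hv⟩, rfl⟩
    refine (forall_occ_eq_iff (List.length_rotate s n) fun t ht => ?_).1 (mem_LC_iff.1 hs)
    rw [List.length_rotate] at ht
    rcases lt_or_ge t n with h | h
    · rw [List.getElem?_append_left (by simpa using h), hv ⟨t, h⟩]
      simp [h]
    · rw [List.getElem?_append_right (by simpa using h), List.length_ofFn,
        List.getElem?_rotate (by omega), Nat.sub_add_cancel h]
  · intro hw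
    have hL : 0 < w.length := by
      rw [List.length_pos_iff]
      rintro rfl
      have := hw v (Classical.arbitrary Ω)
      simp only [exits, List.count_nil] at this
      omega
    obtain ⟨s, rfl⟩ : ∃ s : List Ω, s.rotate n = w := by
      refine ⟨w.rotate (w.length * n - n), ?_⟩
      rw [List.rotate_rotate, Nat.sub_add_cancel (Nat.le_mul_of_pos_left n hL),
        List.rotate_length_mul]
    have hend := foldl_eq_of_count_exits shift hw sum_shift_eq
    -- The walk closes up, so the text `v w` ends with `v`.
    have hper : ∀ t < n, (List.ofFn v ++ s.rotate n)[t]? =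
        (List.ofFn v ++ s.rotate n)[t + s.length]? := by
      intro t ht
      have h1 := ofFn_foldl_shift v (s.rotate n)
      rw [hend, List.length_rotate] at h1
      have h2 := congrArg (fun l => l[t]?) h1
      simp only [List.getElem?_drop] at h2
      rw [List.getElem?_append_left (by simpa using ht), h2, add_comm]
    -- Induction on the distance `r` to the end of the text; several periods may be needed, as `s`
    -- can be shorter than `n`.
    have hext : ∀ r t, t + r = n + s.length → 0 < r →
        (List.ofFn v ++ s.rotate n)[t]? = s[t % s.length]? := by
      intro r
      induction r using Nat.strong_induction_on with
      | _ r ih =>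
        intro t ht hr
        rw [List.length_rotate] at hL
        rcases lt_or_ge t n with h | h
        · rw [hper t h, ih (r - s.length) (by omega) (t + s.length) (by omega) (by omega),
            Nat.add_mod_right]
        · rw [List.getElem?_append_right (by simpa using h), List.length_ofFn,
            List.getElem?_rotate (by omega), Nat.sub_add_cancel h]
    have hext' : ∀ t < n + (s.rotate n).length,
        (List.ofFn v ++ s.rotate n)[t]? = s[t % s.length]? := by
      intro t ht
      rw [List.length_rotate] at ht
      exact hext (n + s.length - t) t (by omega) (by omega)
    refine ⟨s, ⟨mem_LC_iff.2 ((forall_occ_eq_iff (List.length_rotate s n) hext').2 hw),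
      fun j => ?_⟩, rfl⟩
    rw [← hext' j (by have := j.2; omega), List.getElem?_append_left (by simp)]
    simp

theorem ncard_LC_startsWith {n m : ℕ} (hm : 0 < m) [Nonempty Ω] (v : Fin n → Ω) :
    (Set.ncard {s ∈ LC Ω m (n + 1) | StartsWith s v} : ℚ) =
      W m (Fintype.card Ω) (n + 1) / (Fintype.card Ω : ℚ) ^ n := by
  rw [← Set.ncard_image_of_injective _ (List.rotate_injective n), image_rotate_startsWith hm v,
    ncard_walks shift hm v sum_shift_eq n fun u x => ?_]
  · simp [W]
  · rw [transition_shift_pow n le_rfl, if_pos fun j h => absurd h (by omega)]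
    simp

omit [Fintype Ω] [DecidableEq Ω] in
theorem existsUnique_startsWith {s : List Ω} (hs : s ≠ []) (k : ℕ) :
    ∃! y : Fin k → Ω, StartsWith s y := by
  have hL : 0 < s.length := List.length_pos_iff.2 hs
  refine ⟨fun j => s[(j : ℕ) % s.length]'(Nat.mod_lt _ hL), fun j => ?_, fun y hy => ?_⟩
  · rw [List.getElem?_eq_getElem (Nat.mod_lt _ hL)]
  · ext j
    have := hy j
    rw [List.getElem?_eq_getElem (Nat.mod_lt _ hL), Option.some.injEq] at this
    exact this.symm

theorem sum_startsWith {s : List Ω} (hs : s ≠ []) (k : ℕ) :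
    ∑ y : Fin k → Ω, (if StartsWith s y then 1 else 0) = 1 := by
  obtain ⟨y, hy, huniq⟩ := existsUnique_startsWith hs k
  rw [Finset.sum_eq_single y, if_pos hy]
  · exact fun z _ hz => if_neg fun h => hz (huniq z h)
  · exact fun h => absurd (mem_univ y) h

theorem length_eq_sum_occ (s : List Ω) (k : ℕ) : s.length = ∑ y : Fin k → Ω, occ s y := by
  rcases eq_or_ne s [] with rfl | hs
  · simp [occ]
  · simp only [occ, Finset.card_filter]
    rw [Finset.sum_comm, Finset.sum_congr rfl fun i _ => sum_startsWith (by simpa using hs) k]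
    simp

theorem length_of_mem_LC {m k : ℕ} {s : List Ω} (hs : s ∈ LC Ω m k) :
    s.length = m * Fintype.card Ω ^ k := by
  rw [length_eq_sum_occ s k, Finset.sum_congr rfl fun y _ => mem_LC_iff.1 hs y]
  simp [mul_comm]

theorem finite_LC (m k : ℕ) : (LC Ω m k).Finite :=
  (List.finite_length_eq Ω (m * Fintype.card Ω ^ k)).subset fun _ hs => length_of_mem_LC hs

theorem ne_nil_of_mem_LC {m k : ℕ} (hm : 0 < m) [Nonempty Ω] {s : List Ω} (hs : s ∈ LC Ω m k) :
    s ≠ [] := by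
  rw [← List.length_pos_iff, length_of_mem_LC hs]
  have : 0 < Fintype.card Ω := Fintype.card_pos
  positivity

omit [Fintype Ω] in
theorem rotate_mem_LC {m k : ℕ} {s : List Ω} (hs : s ∈ LC Ω m k) (i : ℕ) :
    s.rotate i ∈ LC Ω m k := fun y => (occ_rotate s i y).trans (hs y)

theorem ncard_LC {m k : ℕ} (hm : 0 < m) (hk : 0 < k) [Nonempty Ω] :
    ((LC Ω m k).ncard : ℚ) = W m (Fintype.card Ω) k := by
  obtain ⟨n, rfl⟩ : ∃ n, k = n + 1 := ⟨k - 1, by omega⟩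
  have hsum : (LC Ω m (n + 1)).ncard =
      ∑ v : Fin n → Ω, Set.ncard {s ∈ LC Ω m (n + 1) | StartsWith s v} := by
    have hset : ∀ v : Fin n → Ω, Set.ncard {s ∈ LC Ω m (n + 1) | StartsWith s v} =
        ((finite_LC m (n + 1)).toFinset.filter fun s => StartsWith s v).card := by
      intro v
      rw [← Set.ncard_coe_finset]
      congr 1
      ext s
      simp
    simp only [hset, Finset.card_filter]
    rw [Finset.sum_comm, Finset.sum_congr rfl fun s hs => sum_startsWith
      (ne_nil_of_mem_LC hm ((finite_LC m (n + 1)).mem_toFinset.1 hs)) n,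
      Set.ncard_eq_toFinset_card _ (finite_LC m (n + 1))]
    simp
  have hq : (Fintype.card Ω : ℚ) ≠ 0 := by simp
  rw [hsum, Nat.cast_sum, Finset.sum_congr rfl fun v _ => ncard_LC_startsWith hm v]
  simp
  field_simp

omit [Fintype Ω] in
/-- In a rotation-invariant set of sequences of length `L` in which `y` occurs `m` times, the
proportion of the sequences that start with `y` is `m / L`. -/
theorem length_mul_ncard_startsWith {k : ℕ} {S : Set (List Ω)} (hS : S.Finite) {L m : ℕ}
    (y : Fin k → Ω) (hlen : ∀ s ∈ S, s.length = L) (hrot : ∀ s ∈ S, ∀ i, s.rotate i ∈ S)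
    (hocc : ∀ s ∈ S, occ s y = m) :
    L * Set.ncard {s ∈ S | StartsWith s y} = m * S.ncard := by
  set F := hS.toFinset with hF
  have hmem : ∀ s, s ∈ F ↔ s ∈ S := fun s => hS.mem_toFinset
  have h1 : Set.ncard {s ∈ S | StartsWith s y} = (F.filter fun s => StartsWith s y).card := by
    rw [← Set.ncard_coe_finset]
    congr 1
    ext s
    simp [hmem]
  have himg : ∀ i, F.image (fun s => s.rotate i) = F := by
    intro i
    refine Finset.eq_of_subset_of_card_le ?_ ?_
    · intro s hs
      obtain ⟨t, ht, rfl⟩ := mem_image.1 hs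
      exact (hmem _).2 (hrot t ((hmem t).1 ht) i)
    · rw [Finset.card_image_of_injective _ (List.rotate_injective i)]
  have h2 : ∀ i, (F.filter fun s => StartsWith (s.rotate i) y).card =
      (F.filter fun s => StartsWith s y).card := by
    intro i
    conv_rhs => rw [← himg i, Finset.filter_image,
      Finset.card_image_of_injective _ (List.rotate_injective i)]
  -- Double count of the pairs of a sequence and a position at which `y` occurs in it.
  have h3 : ∑ s ∈ F, occ s y = ∑ i ∈ range L, (F.filter fun s => StartsWith (s.rotate i) y).card := by
    simp only [Finset.card_filter]
    rw [Finset.sum_comm]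
    refine Finset.sum_congr rfl fun s hs => ?_
    rw [occ, hlen s ((hmem s).1 hs), Finset.card_filter]
  rw [Finset.sum_congr rfl fun s hs => hocc s ((hmem s).1 hs)] at h3
  simp only [h2, sum_const, smul_eq_mul, card_range] at h3
  rw [h1, ← h3, Set.ncard_eq_toFinset_card _ hS, mul_comm]

end Linearizations

/-! ### Powers, roots and orders -/

section Orders

variable {Ω : Type*}

/-- `rho` and `List.rotate` turn in opposite directions, and inverse maps have the same fixed
points. -/
theorem rho_iterate_eq_self_iff (s : List Ω) (i : ℕ) : rho^[i] s = s ↔ s.rotate i = s := by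
  have hinv : ∀ i, rho^[i] (s.rotate i) = s := by
    intro i
    induction i with
    | zero => simp
    | succ i ih =>
      rw [Function.iterate_succ_apply]
      have : rho (s.rotate (i + 1)) = s.rotate i := by
        rcases eq_or_ne s [] with rfl | hs
        · simp [rho]
        · have hL := List.length_pos_iff.2 hs
          rw [rho, List.length_rotate, List.rotate_rotate,
            show i + 1 + (s.length - 1) = s.length + i by omega, ← List.rotate_rotate,
            List.rotate_length]
      rw [this, ih]
  constructor
  · intro h
    have := hinv i
    rwa [rho_iterate_rotate, h] at this
  · intro h
    conv_lhs => rw [← h]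
    exact hinv i

theorem rotate_mul_eq_self {s : List Ω} {i : ℕ} (h : s.rotate i = s) (x : ℕ) :
    s.rotate (i * x) = s := by
  induction x with
  | zero => simp
  | succ x ih => rw [Nat.mul_succ, ← List.rotate_rotate, ih, h]

theorem rotate_gcd_eq_self {s : List Ω} {i j : ℕ} (hj : 0 < j) (hi : s.rotate i = s)
    (hj' : s.rotate j = s) : s.rotate (Nat.gcd i j) = s := by
  rcases (Nat.gcd_le_right i hj).lt_or_eq with h | h
  · obtain ⟨x, -, hx⟩ := Nat.exists_mul_mod_eq_gcd h
    have h1 := rotate_mul_eq_self hi x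
    rw [← Nat.mod_add_div (i * x) j, hx, add_comm, ← List.rotate_rotate,
      rotate_mul_eq_self hj'] at h1
    exact h1
  · rw [h, hj']

theorem seqPow_succ (t : List Ω) (d : ℕ) : seqPow t (d + 1) = t ++ seqPow t d := by
  simp [seqPow, List.replicate_succ]

theorem length_seqPow (t : List Ω) (d : ℕ) : (seqPow t d).length = d * t.length := by
  simp [seqPow]

theorem getElem?_seqPow (t : List Ω) (d i : ℕ) (hi : i < d * t.length) :
    (seqPow t d)[i]? = t[i % t.length]? := by
  induction d generalizing i with
  | zero => simp at hi
  | succ d ih =>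
    rw [seqPow_succ]
    rcases lt_or_ge i t.length with h | h
    · rw [List.getElem?_append_left h, Nat.mod_eq_of_lt h]
    · rw [List.getElem?_append_right h, ih _ (by rw [Nat.succ_mul] at hi; omega),
        ← Nat.mod_eq_sub_mod h]

/-- Reading cyclically, a sequence and its powers are the same. -/
theorem getElem?_seqPow_mod (t : List Ω) {d : ℕ} (hd : 0 < d) (i : ℕ) :
    (seqPow t d)[i % (seqPow t d).length]? = t[i % t.length]? := by
  rcases Nat.eq_zero_or_pos t.length with h | h
  · rw [List.length_eq_zero_iff.1 h]
    simp [seqPow]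
  · rw [length_seqPow, getElem?_seqPow _ _ _ (Nat.mod_lt _ (Nat.mul_pos hd h)),
      Nat.mod_mul_left_mod]

theorem seqPow_rotate (t : List Ω) {d : ℕ} (hd : 0 < d) (i : ℕ) :
    (seqPow t d).rotate i = seqPow (t.rotate i) d := by
  refine List.ext_getElem? fun j => ?_
  rcases lt_or_ge j (d * t.length) with h | h
  · have h1 := getElem?_rotate_mod (seqPow t d) i j
    rw [getElem?_seqPow_mod t hd, List.length_rotate, length_seqPow, Nat.mod_eq_of_lt h] at h1
    rw [h1, getElem?_seqPow _ _ _ (by rwa [List.length_rotate]), getElem?_rotate_mod]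
  · rw [List.getElem?_eq_none (by simpa [length_seqPow] using h),
      List.getElem?_eq_none (by simpa [length_seqPow] using h)]

theorem seqRoot_seqPow (t : List Ω) {d : ℕ} (hd : 0 < d) : seqRoot d (seqPow t d) = t := by
  rw [seqRoot, length_seqPow, Nat.mul_div_cancel_left _ hd]
  obtain ⟨e, rfl⟩ : ∃ e, d = e + 1 := ⟨d - 1, by omega⟩
  rw [seqPow_succ, List.take_left]

theorem eq_seqPow_of_rotate {s : List Ω} {d : ℕ} (hd : d ∣ s.length)
    (h : s.rotate (s.length / d) = s) : s = seqPow (seqRoot d s) d := by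
  obtain ⟨p, hp⟩ := hd
  rcases Nat.eq_zero_or_pos s.length with h0 | h0
  · rw [List.length_eq_zero_iff.1 h0]
    simp [seqRoot, seqPow]
  have hdpos : 0 < d := Nat.pos_of_ne_zero fun h => by simp [h, hp] at h0
  have hppos : 0 < p := Nat.pos_of_ne_zero fun h => by simp [h, hp] at h0
  rw [hp, Nat.mul_div_cancel_left _ hdpos] at h
  have hroot : seqRoot d s = s.take p := by rw [seqRoot, hp, Nat.mul_div_cancel_left _ hdpos]
  have hple : p ≤ s.length := by rw [hp]; exact Nat.le_mul_of_pos_left p hdpos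
  have hlen : (s.take p).length = p := by simp [hple]
  rw [hroot]
  refine List.ext_getElem? fun j => ?_
  rcases lt_or_ge j s.length with hj | hj
  · rw [getElem?_seqPow _ _ _ (by rw [hlen, ← hp]; exact hj), hlen,
      List.getElem?_take_of_lt (Nat.mod_lt _ hppos)]
    have h1 := List.getElem?_rotate (n := p * (j / p)) (lt_of_le_of_lt (Nat.mod_le j p) hj)
    rw [rotate_mul_eq_self h, Nat.mod_add_div, Nat.mod_eq_of_lt hj] at h1
    exact h1.symm
  · rw [List.getElem?_eq_none hj,
      List.getElem?_eq_none (by rw [length_seqPow, hlen, ← hp]; exact hj)]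

theorem startsWith_seqPow {k d : ℕ} (hd : 0 < d) (t : List Ω) (y : Fin k → Ω) :
    StartsWith (seqPow t d) y ↔ StartsWith t y := by
  simp only [StartsWith, getElem?_seqPow_mod t hd]

variable [DecidableEq Ω]

theorem occ_seqPow {k : ℕ} (t : List Ω) (d : ℕ) (y : Fin k → Ω) :
    occ (seqPow t d) y = d * occ t y := by
  rcases Nat.eq_zero_or_pos d with rfl | hd
  · simp [occ, seqPow]
  have hper : ∀ i, StartsWith (t.rotate (t.length + i)) y ↔ StartsWith (t.rotate i) y := by
    intro i
    rw [← List.rotate_rotate, List.rotate_length]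
  have key : ∀ e, ((range (e * t.length)).filter fun i => StartsWith (t.rotate i) y).card =
      e * occ t y := by
    intro e
    induction e with
    | zero => simp
    | succ e ih =>
      rw [Nat.succ_mul, add_comm, Finset.card_filter, Finset.sum_range_add]
      simp only [hper]
      rw [← Finset.card_filter, ← Finset.card_filter, ih, occ]
      ring
  rw [occ, length_seqPow, ← key d]
  congr 1
  refine Finset.filter_congr fun i _ => ?_
  rw [seqPow_rotate t hd, startsWith_seqPow hd]

theorem order_eq_sup (s : List Ω) :
    order s = ((Nat.divisors s.length).filter fun d => s.rotate (s.length / d) = s).sup id := by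
  simp only [order, rho_iterate_eq_self_iff]

theorem le_order {s : List Ω} (hs : s ≠ []) {e : ℕ} (he : e ∣ s.length)
    (h : s.rotate (s.length / e) = s) : e ≤ order s := by
  rw [order_eq_sup]
  refine Finset.le_sup (f := id) (mem_filter.2 ⟨Nat.mem_divisors.2 ⟨he, ?_⟩, h⟩)
  simpa using hs

theorem order_spec {s : List Ω} (hs : s ≠ []) :
    order s ∣ s.length ∧ s.rotate (s.length / order s) = s := by
  have hL : s.length ≠ 0 := by simpa using hs
  have hne : ((Nat.divisors s.length).filter fun d => s.rotate (s.length / d) = s).Nonempty :=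
    ⟨1, mem_filter.2 ⟨Nat.mem_divisors.2 ⟨one_dvd _, hL⟩, by simp⟩⟩
  obtain ⟨e, he, h⟩ := Finset.exists_mem_eq_sup _ hne id
  rw [← order_eq_sup, id] at h
  rw [h]
  rw [mem_filter, Nat.mem_divisors] at he
  exact ⟨he.1.1, he.2⟩

theorem order_pos {s : List Ω} (hs : s ≠ []) : 0 < order s :=
  Nat.pos_of_dvd_of_pos (order_spec hs).1 (List.length_pos_iff.2 hs)

theorem eq_seqPow_order {s : List Ω} (hs : s ≠ []) : s = seqPow (seqRoot (order s) s) (order s) :=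
  eq_seqPow_of_rotate (order_spec hs).1 (order_spec hs).2

/-- A rotation fixing a sequence of order one is by a multiple of its length. -/
theorem dvd_of_rotate_eq_self {t : List Ω} (ht : t ≠ []) (h1 : order t = 1) {i : ℕ}
    (hi : t.rotate i = t) : t.length ∣ i := by
  have hL := List.length_pos_iff.2 ht
  have hg := rotate_gcd_eq_self hL hi (List.rotate_length t)
  have hdvd : Nat.gcd i t.length ∣ t.length := Nat.gcd_dvd_right _ _
  have hle := le_order ht (Nat.div_dvd_of_dvd hdvd) (by rwa [Nat.div_div_self hdvd hL.ne'])
  have hpos := Nat.div_pos (Nat.le_of_dvd hL hdvd) (Nat.gcd_pos_of_pos_right i hL)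
  have hone : t.length / Nat.gcd i t.length = 1 := by omega
  rw [← Nat.eq_of_dvd_of_div_eq_one hdvd hone]
  exact Nat.gcd_dvd_left _ _

omit [DecidableEq Ω] in
theorem seqPow_ne_nil {t : List Ω} (ht : t ≠ []) {d : ℕ} (hd : 0 < d) : seqPow t d ≠ [] := by
  rw [← List.length_pos_iff, length_seqPow]
  exact Nat.mul_pos hd (List.length_pos_iff.2 ht)

/-- A rotation fixing the power fixes `t`, hence is by a multiple of `t.length`; this makes the
order of the power divide `d`. -/
theorem order_seqPow {t : List Ω} (ht : t ≠ []) (h1 : order t = 1) {d : ℕ} (hd : 0 < d) :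
    order (seqPow t d) = d := by
  have hL := List.length_pos_iff.2 ht
  have hs := seqPow_ne_nil ht hd
  apply le_antisymm
  · obtain ⟨hdvd, hrot⟩ := order_spec hs
    have hpos := order_pos hs
    set e := order (seqPow t d)
    rw [seqPow_rotate t hd] at hrot
    have hrot' := congrArg (seqRoot d) hrot
    rw [seqRoot_seqPow _ hd, seqRoot_seqPow _ hd] at hrot'
    obtain ⟨x, hx⟩ := dvd_of_rotate_eq_self ht h1 hrot'
    have h2 : e * (t.length * x) = d * t.length := by
      rw [← hx, Nat.mul_div_cancel' hdvd, length_seqPow]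
    have h3 : e * x = d := by
      apply Nat.eq_of_mul_eq_mul_left hL
      linarith
    exact Nat.le_of_dvd hd ⟨x, h3.symm⟩
  · refine le_order hs ⟨t.length, length_seqPow t d⟩ ?_
    rw [length_seqPow, Nat.mul_div_cancel_left _ hd, seqPow_rotate t hd, List.rotate_length]

theorem order_eq_one_of_order_seqPow {t : List Ω} (ht : t ≠ []) {d : ℕ} (hd0 : 0 < d)
    (hd : order (seqPow t d) = d) : order t = 1 := by
  apply le_antisymm
  · obtain ⟨hdvd, hrot⟩ := order_spec ht
    have hs := seqPow_ne_nil ht hd0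
    have h := le_order hs (e := d * order t)
      (by rw [length_seqPow]; exact Nat.mul_dvd_mul_left d hdvd) (by
        rw [length_seqPow, Nat.mul_div_mul_left _ _ hd0, seqPow_rotate t hd0, hrot])
    rw [hd] at h
    exact Nat.le_of_mul_le_mul_left (by rwa [mul_one]) hd0
  · exact order_pos ht

end Orders

/-! ### The root bijections -/

section Roots

variable {Ω : Type*} [DecidableEq Ω] [Fintype Ω] [Nonempty Ω] {m k d : ℕ}

theorem seqPow_seqRoot (hm : 0 < m) {s : List Ω} (hs : s ∈ LCOrd Ω d m k) :
    seqPow (seqRoot d s) d = s := by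
  obtain ⟨h, rfl⟩ := hs
  exact (eq_seqPow_order (ne_nil_of_mem_LC hm h)).symm

omit [Fintype Ω] [Nonempty Ω] in
theorem seqPow_mem_LC_iff (hd : 0 < d) (hdm : d ∣ m) {t : List Ω} :
    seqPow t d ∈ LC Ω m k ↔ t ∈ LC Ω (m / d) k := by
  obtain ⟨e, rfl⟩ := hdm
  simp only [mem_LC_iff, occ_seqPow, Nat.mul_div_cancel_left _ hd,
    Nat.mul_right_inj hd.ne']

theorem seqRoot_mem_LCOrd (hm : 0 < m) (hdm : d ∣ m) {s : List Ω} (hs : s ∈ LCOrd Ω d m k) :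
    seqRoot d s ∈ LCOrd Ω 1 (m / d) k := by
  have hd := Nat.pos_of_dvd_of_pos hdm hm
  have hpow := seqPow_seqRoot hm hs
  obtain ⟨h, hord⟩ := hs
  rw [← hpow] at h hord
  have hmem := (seqPow_mem_LC_iff hd hdm).1 h
  exact ⟨hmem, order_eq_one_of_order_seqPow
    (ne_nil_of_mem_LC (Nat.div_pos (Nat.le_of_dvd hm hdm) hd) hmem) hd hord⟩

theorem seqPow_mem_LCOrd (hm : 0 < m) (hdm : d ∣ m) {t : List Ω}
    (ht : t ∈ LCOrd Ω 1 (m / d) k) : seqPow t d ∈ LCOrd Ω d m k := by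
  have hd := Nat.pos_of_dvd_of_pos hdm hm
  exact ⟨(seqPow_mem_LC_iff hd hdm).2 ht.1, order_seqPow
    (ne_nil_of_mem_LC (Nat.div_pos (Nat.le_of_dvd hm hdm) hd) ht.1) ht.2 hd⟩

theorem bijOn_seqRoot (hm : 0 < m) (hdm : d ∣ m) :
    Set.BijOn (seqRoot d) (LCOrd Ω d m k) (LCOrd Ω 1 (m / d) k) :=
  Set.InvOn.bijOn (f' := fun t => seqPow t d)
    ⟨fun _ hs => seqPow_seqRoot hm hs,
      fun t _ => seqRoot_seqPow t (Nat.pos_of_dvd_of_pos hdm hm)⟩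
    (fun _ hs => seqRoot_mem_LCOrd hm hdm hs) (fun _ ht => seqPow_mem_LCOrd hm hdm ht)

theorem bijOn_seqRoot_start (hm : 0 < m) (hdm : d ∣ m) (y : Fin k → Ω) :
    Set.BijOn (seqRoot d) (LCOrdStart y d m) (LCOrdStart y 1 (m / d)) := by
  have hd := Nat.pos_of_dvd_of_pos hdm hm
  refine Set.InvOn.bijOn (f' := fun t => seqPow t d)
    ⟨fun s hs => seqPow_seqRoot hm hs.1, fun t _ => seqRoot_seqPow t hd⟩ ?_ ?_
  · intro s hs
    refine ⟨seqRoot_mem_LCOrd hm hdm hs.1, ?_⟩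
    have h := hs.2
    rwa [← seqPow_seqRoot hm hs.1, startsWith_seqPow hd] at h
  · exact fun t ht => ⟨seqPow_mem_LCOrd hm hdm ht.1, (startsWith_seqPow hd t y).2 ht.2⟩

theorem isRotated_seqRoot (hm : 0 < m) (hdm : d ∣ m) {s s' : List Ω} (hs : s ∈ LCOrd Ω d m k)
    (h : s ~r s') : seqRoot d s ~r seqRoot d s' := by
  have hd := Nat.pos_of_dvd_of_pos hdm hm
  obtain ⟨i, rfl⟩ := h
  refine ⟨i, ?_⟩
  conv_rhs => rw [← seqPow_seqRoot hm hs, seqPow_rotate _ hd, seqRoot_seqPow _ hd]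

omit [Fintype Ω] [Nonempty Ω] in
theorem coe_mem_COrd {s : List Ω} : (s : Cycle Ω) ∈ COrd Ω d m k ↔ s ∈ LCOrd Ω d m k := Iff.rfl

/-- The root of a cyclic sequence, computed on a linearization. -/
noncomputable def cyclicRoot (d : ℕ) (σ : Cycle Ω) : Cycle Ω := (seqRoot d (Quotient.out σ) : Cycle Ω)

theorem cyclicRoot_coe (hm : 0 < m) (hdm : d ∣ m) {s : List Ω} (hs : s ∈ LCOrd Ω d m k) :
    cyclicRoot d (s : Cycle Ω) = (seqRoot d s : Cycle Ω) :=
  (Cycle.coe_eq_coe.2 (isRotated_seqRoot hm hdm hs (List.IsRotated.symm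
    (Quotient.mk_out (s := List.IsRotated.setoid Ω) s)))).symm

theorem bijOn_cyclicRoot (hm : 0 < m) (hdm : d ∣ m) :
    Set.BijOn (cyclicRoot d) (COrd Ω d m k) (COrd Ω 1 (m / d) k) := by
  have hd := Nat.pos_of_dvd_of_pos hdm hm
  refine ⟨?_, ?_, ?_⟩
  · intro σ
    induction σ using Quotient.inductionOn with
    | _ s =>
      intro hs
      have := cyclicRoot_coe hm hdm (coe_mem_COrd.1 hs)
      exact this ▸ coe_mem_COrd.2 (seqRoot_mem_LCOrd hm hdm (coe_mem_COrd.1 hs))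
  · intro σ hσ τ hτ
    induction σ using Quotient.inductionOn with
    | _ s =>
      induction τ using Quotient.inductionOn with
      | _ t =>
        intro h
        have hs := coe_mem_COrd.1 hσ
        have ht := coe_mem_COrd.1 hτ
        have h' : (seqRoot d s : Cycle Ω) = (seqRoot d t : Cycle Ω) :=
          (cyclicRoot_coe hm hdm hs).symm.trans (h.trans (cyclicRoot_coe hm hdm ht))
        obtain ⟨i, hi⟩ := Cycle.coe_eq_coe.1 h'
        refine Cycle.coe_eq_coe.2 ⟨i, ?_⟩
        rw [← seqPow_seqRoot hm hs, seqPow_rotate _ hd, hi, seqPow_seqRoot hm ht]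
  · intro τ
    induction τ using Quotient.inductionOn with
    | _ t =>
      intro ht
      have hs := seqPow_mem_LCOrd hm hdm (coe_mem_COrd.1 ht)
      refine ⟨(seqPow t d : Cycle Ω), coe_mem_COrd.2 hs, ?_⟩
      rw [cyclicRoot_coe hm hdm hs, seqRoot_seqPow t hd]
      rfl

end Roots

/-! ### Counting by order and Möbius inversion -/

section Counting

variable {Ω : Type*} [DecidableEq Ω] [Fintype Ω] {m k d : ℕ}

theorem finite_LCOrd (d m k : ℕ) : (LCOrd Ω d m k).Finite :=
  (finite_LC m k).subset fun _ h => h.1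

omit [Fintype Ω] in
theorem image_coe_LCOrd (d m k : ℕ) :
    (fun s : List Ω => (s : Cycle Ω)) '' LCOrd Ω d m k = COrd Ω d m k := by
  ext σ
  induction σ using Quotient.inductionOn with
  | _ s =>
    constructor
    · rintro ⟨t, ht, hts⟩
      exact hts ▸ coe_mem_COrd.2 ht
    · exact fun hs => ⟨s, coe_mem_COrd.1 hs, rfl⟩

theorem finite_COrd (d m k : ℕ) : (COrd Ω d m k).Finite := by
  rw [← image_coe_LCOrd]
  exact (finite_LCOrd d m k).image _

omit [Fintype Ω] in
theorem rotate_mem_LCOrd {s : List Ω} (hs : s ∈ LCOrd Ω d m k) (i : ℕ) :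
    s.rotate i ∈ LCOrd Ω d m k :=
  ⟨rotate_mem_LC hs.1 i, (order_rotate s i).trans hs.2⟩

omit [Fintype Ω] in
theorem rotate_injOn_of_order_eq_one {s : List Ω} (hs : s ≠ []) (h1 : order s = 1) :
    Set.InjOn (fun i => s.rotate i) (range s.length : Set ℕ) := by
  have key : ∀ i j, i ≤ j → j < s.length → s.rotate i = s.rotate j → i = j := by
    intro i j hij hj h
    have h2 : s.rotate (j - i) = s := by
      rw [← List.rotate_eq_rotate (n := i), List.rotate_rotate, Nat.sub_add_cancel hij, h]
    have := Nat.eq_zero_of_dvd_of_lt (dvd_of_rotate_eq_self hs h1 h2) (by omega)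
    omega
  intro i hi j hj h
  simp only [coe_range, Set.mem_Iio] at hi hj
  rcases le_total i j with hij | hij
  · exact key i j hij hj h
  · exact (key j i hij hi h.symm).symm

variable [Nonempty Ω]

/-- The fibres of passing to cyclic sequences are rotation classes, and the rotations of a sequence
of order 1 are distinct. -/
theorem length_mul_ncard_COrd_one (hm : 0 < m) :
    m * Fintype.card Ω ^ k * (COrd Ω 1 m k).ncard = (LCOrd Ω 1 m k).ncard := by
  classical
  have hmem : ∀ s, s ∈ (finite_LCOrd 1 m k).toFinset ↔ s ∈ LCOrd Ω 1 m k :=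
    fun s => (finite_LCOrd 1 m k).mem_toFinset
  rw [Set.ncard_eq_toFinset_card _ (finite_LCOrd 1 m k),
    Set.ncard_eq_toFinset_card _ (finite_COrd 1 m k),
    Finset.card_eq_sum_card_fiberwise (f := fun s : List Ω => (s : Cycle Ω))
      (t := (finite_COrd 1 m k).toFinset)
      (fun s hs => by simpa using coe_mem_COrd.2 ((hmem s).1 hs)),
    Finset.sum_const_nat (m := m * Fintype.card Ω ^ k), mul_comm]
  intro σ hσ
  rw [(finite_COrd 1 m k).mem_toFinset, ← image_coe_LCOrd] at hσ
  obtain ⟨s, hs, rfl⟩ := hσ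
  have hfib : ((finite_LCOrd 1 m k).toFinset.filter fun t : List Ω => (t : Cycle Ω) = s) =
      (range s.length).image fun i => s.rotate i := by
    ext t
    simp only [mem_filter, hmem, mem_image, mem_range, Cycle.coe_eq_coe]
    constructor
    · rintro ⟨-, ht⟩
      obtain ⟨i, hi⟩ := ht.symm
      exact ⟨i % s.length, Nat.mod_lt _ (List.length_pos_iff.2 (ne_nil_of_mem_LC hm hs.1)),
        by rw [List.rotate_mod, hi]⟩
    · rintro ⟨i, -, rfl⟩
      exact ⟨rotate_mem_LCOrd hs i, List.IsRotated.forall s i⟩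
  rw [hfib, Finset.card_image_of_injOn
    (rotate_injOn_of_order_eq_one (ne_nil_of_mem_LC hm hs.1) hs.2), card_range,
    length_of_mem_LC hs.1]

omit [Nonempty Ω] in
theorem card_pow_mul_ncard_LCOrdStart_one (hm : 0 < m) (y : Fin k → Ω) :
    Fintype.card Ω ^ k * (LCOrdStart y 1 m).ncard = (LCOrd Ω 1 m k).ncard := by
  have h := length_mul_ncard_startsWith (finite_LCOrd 1 m k) y
    (fun s hs => length_of_mem_LC hs.1) (fun s hs i => rotate_mem_LCOrd hs i) (fun s hs => hs.1 y)
  rw [mul_assoc] at h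
  exact Nat.eq_of_mul_eq_mul_left hm h

/-- Every k-mer count of a power is a multiple of the exponent. -/
theorem order_dvd_of_mem_LC (hm : 0 < m) {s : List Ω} (hs : s ∈ LC Ω m k) : order s ∣ m := by
  have h := mem_LC_iff.1 hs (Classical.arbitrary _)
  rw [eq_seqPow_order (ne_nil_of_mem_LC hm hs), occ_seqPow] at h
  exact ⟨_, h.symm⟩

theorem ncard_LC_eq_sum_LCOrd_one (hm : 0 < m) :
    (LC Ω m k).ncard = ∑ d ∈ m.divisors, (LCOrd Ω 1 d k).ncard := by
  -- Reindexing by `d ↦ m / d` matches order `d` with roots counted by `m / d`.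
  rw [← Nat.sum_div_divisors, Set.ncard_eq_toFinset_card _ (finite_LC m k),
    Finset.card_eq_sum_card_fiberwise (f := order) (t := m.divisors)]
  · refine Finset.sum_congr rfl fun d hd => ?_
    rw [← (bijOn_seqRoot hm (Nat.dvd_of_mem_divisors hd)).ncard_eq, ← Set.ncard_coe_finset]
    congr 1
    ext s
    simp [LCOrd]
  · intro s hs
    rw [mem_coe, (finite_LC m k).mem_toFinset] at hs
    exact mem_coe.2 (Nat.mem_divisors.2 ⟨order_dvd_of_mem_LC hm hs, hm.ne'⟩)

theorem ncard_LCOrd_one (hm : 0 < m) (hk : 0 < k) :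
    ((LCOrd Ω 1 m k).ncard : ℚ) = ∑ r ∈ m.divisors,
      (ArithmeticFunction.moebius r : ℚ) * W (m / r) (Fintype.card Ω) k := by
  have h := (ArithmeticFunction.sum_eq_iff_sum_mul_moebius_eq
    (f := fun m => ((LCOrd Ω 1 m k).ncard : ℚ)) (g := fun m => W m (Fintype.card Ω) k)).1
    (fun n hn => by
      rw [← ncard_LC hn hk, ncard_LC_eq_sum_LCOrd_one hn, Nat.cast_sum]) m hm
  rw [← h, Nat.sum_divisorsAntidiagonal
    (f := fun r e => (ArithmeticFunction.moebius r : ℚ) * W e (Fintype.card Ω) k)]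

end Counting

end MultiDeBruijn

end

theorem mainTheorem5 {Ω : Type*} [Fintype Ω] [DecidableEq Ω] (m q k d : ℕ)
    (hm : 1 ≤ m) (hq : 1 ≤ q) (hk : 1 ≤ k) (hΩ : Fintype.card Ω = q) (hd : d ∣ m) :
    -- every sequence of order `d` in question has a unique `d`-th root, namely `seqRoot d s`
    (∀ s ∈ MultiDeBruijn.LCOrd Ω d m k, ∀ t : List Ω,
      s = MultiDeBruijn.seqPow t d ↔ t = MultiDeBruijn.seqRoot d s) ∧
    -- taking the root is a bijection on linearizations
    Set.BijOn (MultiDeBruijn.seqRoot d)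
      (MultiDeBruijn.LCOrd Ω d m k) (MultiDeBruijn.LCOrd Ω 1 (m / d) k) ∧
    -- and on linearizations starting with `y`
    (∀ y : Fin k → Ω, Set.BijOn (MultiDeBruijn.seqRoot d)
      (MultiDeBruijn.LCOrdStart y d m) (MultiDeBruijn.LCOrdStart y 1 (m / d))) ∧
    -- and induces a bijection on cyclic sequences
    (∃ f : Cycle Ω → Cycle Ω,
      (∀ s : List Ω, (s : Cycle Ω) ∈ MultiDeBruijn.COrd Ω d m k →
        f (s : Cycle Ω) = (MultiDeBruijn.seqRoot d s : Cycle Ω)) ∧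
      Set.BijOn f (MultiDeBruijn.COrd Ω d m k) (MultiDeBruijn.COrd Ω 1 (m / d) k)) ∧
    -- finiteness, and equality of cardinalities
    ((MultiDeBruijn.LCOrd Ω d m k).Finite ∧ (MultiDeBruijn.COrd Ω d m k).Finite) ∧
    ((MultiDeBruijn.LCOrd Ω d m k).ncard = (MultiDeBruijn.LCOrd Ω 1 (m / d) k).ncard ∧
      (∀ y : Fin k → Ω, (MultiDeBruijn.LCOrdStart y d m).ncard =
        (MultiDeBruijn.LCOrdStart y 1 (m / d)).ncard) ∧
      (MultiDeBruijn.COrd Ω d m k).ncard = (MultiDeBruijn.COrd Ω 1 (m / d) k).ncard) ∧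
    -- the counting formulas
    ((MultiDeBruijn.COrd Ω d m k).ncard : ℚ) =
      1 / (((m / d : ℕ) : ℚ) * (q : ℚ) ^ k) *
        ∑ r ∈ Nat.divisors (m / d),
          (ArithmeticFunction.moebius r : ℚ) * MultiDeBruijn.W (m / (r * d)) q k ∧
    (∀ y : Fin k → Ω, ((MultiDeBruijn.LCOrdStart y d m).ncard : ℚ) =
      1 / (q : ℚ) ^ k *
        ∑ r ∈ Nat.divisors (m / d),
          (ArithmeticFunction.moebius r : ℚ) * MultiDeBruijn.W (m / (r * d)) q k) := by
  subst hΩ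
  have : Nonempty Ω := Fintype.card_pos_iff.1 hq
  have hd0 : 0 < d := Nat.pos_of_dvd_of_pos hd hm
  have hmd : 0 < m / d := Nat.div_pos (Nat.le_of_dvd hm hd) hd0
  have hq0 : (Fintype.card Ω : ℚ) ≠ 0 := by simp
  have hmd0 : ((m / d : ℕ) : ℚ) ≠ 0 := by exact_mod_cast hmd.ne'
  have hsum : ∑ r ∈ Nat.divisors (m / d), (ArithmeticFunction.moebius r : ℚ) *
      MultiDeBruijn.W (m / (r * d)) (Fintype.card Ω) k =
      ((MultiDeBruijn.LCOrd Ω 1 (m / d) k).ncard : ℚ) := by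
    rw [MultiDeBruijn.ncard_LCOrd_one hmd hk]
    exact Finset.sum_congr rfl fun r _ => by rw [Nat.div_div_eq_div_mul, mul_comm d r]
  have hbij := MultiDeBruijn.bijOn_seqRoot (Ω := Ω) (k := k) hm hd
  have hbijStart := MultiDeBruijn.bijOn_seqRoot_start (Ω := Ω) (k := k) hm hd
  have hbijCyc := MultiDeBruijn.bijOn_cyclicRoot (Ω := Ω) (k := k) hm hd
  refine ⟨fun s hs t => ⟨?_, ?_⟩, hbij, hbijStart,
    ⟨MultiDeBruijn.cyclicRoot d, fun s hs => MultiDeBruijn.cyclicRoot_coe hm hd hs, hbijCyc⟩,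
    ⟨MultiDeBruijn.finite_LCOrd d m k, MultiDeBruijn.finite_COrd d m k⟩,
    ⟨hbij.ncard_eq, fun y => (hbijStart y).ncard_eq, hbijCyc.ncard_eq⟩, ?_, fun y => ?_⟩
  · rintro rfl
    exact (MultiDeBruijn.seqRoot_seqPow t hd0).symm
  · rintro rfl
    exact (MultiDeBruijn.seqPow_seqRoot hm hs).symm
  · rw [hsum, hbijCyc.ncard_eq, ← MultiDeBruijn.length_mul_ncard_COrd_one hmd]
    push_cast
    field_simp
  · rw [hsum, (hbijStart y).ncard_eq, ← MultiDeBruijn.card_pow_mul_ncard_LCOrdStart_one hmd y]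
    push_cast
    field_simp
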